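/- Let $\Bbbk$ be an algebraically closed field, let $n\ge 0$, and let $Q$ be a quiver of type $\mathbb{A}_{n+2}$, that is, any orientation of the path graph with vertices $1,2,\dots,n+2$. Let $\operatorname{rep} Q$ be the category of finite-dimensional representations of $Q$ over $\Bbbk$, and write $\operatorname{Ext}=\operatorname{Ext}^1_{\operatorname{rep} Q}$. A representation $T\in\operatorname{rep} Q$ is called basic if it has no repeated direct summands, i.e. there is no indecomposable $A$ such that $A\oplus A$ is isomorphic to a direct summand of $T$. It is called almost rigid if it is basic and, for every pair $A,B$ of indecomposable direct summands of $T$, either $\operatorname{Ext}(A,B)=0$, or $\operatorname{Ext}(A,B)\cong\Bbbk$ and it is generated by the class of a short exact sequence $0\to B\to E\to A\to 0$ whose middle term $E$ is indecomposable. It is called maximal almost rigid if $T$ is almost rigid and $T\oplus M$ is not almost rigid for any nonzero $M\in\operatorname{rep} Q$. Then every maximal almost rigid representation of $Q$ has exactly $2n+3$ indecomposable summands: it is a direct sum of $2n+3$ indecomposable representations, and every decomposition of it into a finite direct sum of indecomposable representations has exactly $2n+3$ terms. Moreover, the number of isomorphism classes of maximal almost rigid representations of $Q$ is the Catalan number $$C_{n+1}=\frac{1}{n+2}\binom{2n+2}{n+1}.$$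 -/

import Mathlib

open CategoryTheory CategoryTheory.Limits CategoryTheory.Abelian

universe u

/-- The vertices `0, 1, …, n + 1` of a quiver of type `𝔸_{n+2}`, labelled in linear order. The
orientation is recorded by `ε`: the `i`-th edge (between the vertices `i` and `i + 1`) points from
`i` to `i + 1` if `ε i = true` and from `i + 1` to `i` if `ε i = false`. -/
def TypeA (n : ℕ) (_ε : Fin (n + 1) → Bool) : Type := Fin (n + 2)

namespace TypeA

/-- The arrows of the quiver of type `𝔸_{n+2}` with orientation `ε`: one for every `i`. -/
inductive Arrow (n : ℕ) (ε : Fin (n + 1) → Bool) : Fin (n + 2) → Fin (n + 2) → Type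
  | right (i : Fin (n + 1)) (h : ε i = true) : Arrow n ε i.castSucc i.succ
  | left (i : Fin (n + 1)) (h : ε i = false) : Arrow n ε i.succ i.castSucc

instance (n : ℕ) (ε : Fin (n + 1) → Bool) : Quiver (TypeA n ε) where
  Hom := Arrow n ε

end TypeA

/-- The category `rep Q` of finite dimensional representations over `k` of a quiver `Q` (with
vertex type `V`): functors from the free category on `Q` to finite dimensional vector spaces, i.e.
a vector space for every vertex and an arbitrary linear map for every arrow. -/
abbrev QuiverRep (k : Type u) [Field k] (V : Type) [Quiver.{0} V] : Type (u + 1) :=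
  Paths V ⥤ FGModuleCat.{u} k

namespace QuiverRep

variable {k : Type u} [Field k] {V : Type} [Quiver.{0} V]

/-- `Ext` groups exist in the abelian category `rep Q` (in a large enough universe). -/
instance : HasExt.{u + 1} (QuiverRep k V) := HasExt.standard _

instance : HasFiniteBiproducts (QuiverRep k V) := Abelian.hasFiniteBiproducts

/-- `A` is (isomorphic to) a direct summand of `T`. -/
def IsSummand (A T : QuiverRep k V) : Prop :=
  ∃ B : QuiverRep k V, Nonempty (T ≅ A ⊞ B)

/-- `T` is basic: it has no repeated indecomposable direct summand. -/
def IsBasic (T : QuiverRep k V) : Prop :=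
  ∀ A : QuiverRep k V, Indecomposable A → ¬ IsSummand (A ⊞ A) T

/-- `Ext(A, B) = k`, and it is generated by the class of a short exact sequence
`0 ⟶ B ⟶ E ⟶ A ⟶ 0` whose middle term `E` is indecomposable. -/
def ExtGeneratedByIndecomposable (A B : QuiverRep k V) : Prop :=
  Module.finrank k (Ext.{u + 1} A B 1) = 1 ∧
  ∃ (E : QuiverRep k V) (i : B ⟶ E) (p : E ⟶ A) (w : i ≫ p = 0)
    (hS : (ShortComplex.mk i p w).ShortExact),
    Indecomposable E ∧ Submodule.span k {(hS.extClass : Ext.{u + 1} A B 1)} = ⊤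

/-- `T` is almost rigid. -/
def IsAlmostRigid (T : QuiverRep k V) : Prop :=
  IsBasic T ∧
  ∀ A B : QuiverRep k V, Indecomposable A → Indecomposable B → IsSummand A T → IsSummand B T →
    Subsingleton (Ext.{u + 1} A B 1) ∨ ExtGeneratedByIndecomposable A B

/-- `T` is maximal almost rigid: it is almost rigid, and `T ⊕ M` is not almost rigid for every
nonzero representation `M`. -/
def IsMaximalAlmostRigid (T : QuiverRep k V) : Prop :=
  IsAlmostRigid T ∧ ∀ M : QuiverRep k V, ¬ IsZero M → ¬ IsAlmostRigid (T ⊞ M)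

/-- `T` is the direct sum of `m` indecomposable representations. -/
def IsSumOfIndecomposables (T : QuiverRep k V) (m : ℕ) : Prop :=
  ∃ M : Fin m → QuiverRep k V, (∀ i, Indecomposable (M i)) ∧ Nonempty (T ≅ ⨁ M)

variable (k V) in
/-- `mar(Q)`: the set of isomorphism classes of maximal almost rigid representations of `Q`. -/
def mar : Set (Quotient (isIsomorphicSetoid (QuiverRep k V))) :=
  {c | ∃ T : QuiverRep k V, IsMaximalAlmostRigid T ∧ Quotient.mk _ T = c}

end QuiverRep

/-! Put the points 0, …, n + 2 on a convex polygon from left to right. An inner point t belongs to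
the edge of the quiver between the vertices t - 1 and t; it lies on the upper side if that edge
points right and on the lower side otherwise (`IsUpper`). The chord from a to b stands for the
interval representation with support a, …, b - 1. The claim becomes: maximal almost rigid
representations are the triangulations of this (n + 3)-gon, sides included.

Extensions of interval representations are governed by a system h t - h s = c, one equation per
arrow from the first support to the second, with unknowns on the common support (`IsSolvable`). On a
path such a system is obstructed exactly when equations occur at both ends of the common part, which
says that one chord passes from below the other to above it (`Traverses`, `exists_potential_iff`).
If the supports overlap, the chords cross, and a middle term has dimension two at a common vertex,
so it is decomposable. If the supports are only adjacent, the chords share an endpoint, and the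
interval on the union is an indecomposable middle term whose extension generates Ext. So the Ext
condition holds in both directions exactly for noncrossing chords (`isCompatibility_chordRep`).

Direct sums are controlled by three facts (`IsBrickSystem`): interval representations have only
scalar endomorphisms, a composite there and back between two different ones is zero, and every
nonzero representation has one as a summand. The last is proved by propagating vectors to the right
from the first nonzero vertex (`exists_intervalData`). Hence basic representations are sets of
chords, and maximal almost rigid ones are maximal noncrossing sets. Cutting a triangulation at the
triangle on a fixed side gives the number of segments and the Catalan recursion. -/

namespace QuiverRep

/-! ### Representations as families of linear maps; exactness vertex by vertex -/

section Basic

variable {k : Type u} [Field k] {V : Type} [Quiver.{0} V]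

/-- The vector space of a representation at a vertex. -/
abbrev space (X : QuiverRep k V) (v : V) : Type u := X.obj ((Paths.of V).obj v)

/-- The linear map of a representation at an arrow. -/
def act (X : QuiverRep k V) {s t : V} (α : s ⟶ t) : space X s →ₗ[k] space X t :=
  (X.map ((Paths.of V).map α)).hom.hom

/-- The linear map of a morphism of representations at a vertex. -/
def lin {X Y : QuiverRep k V} (f : X ⟶ Y) (v : V) : space X v →ₗ[k] space Y v :=
  (f.app ((Paths.of V).obj v)).hom.hom

variable {X Y Z : QuiverRep k V}

theorem lin_act (f : X ⟶ Y) {s t : V} (α : s ⟶ t) (x : space X s) :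
    lin f t (act X α x) = act Y α (lin f s x) :=
  congrArg (fun g => g.hom.hom x) (f.naturality ((Paths.of V).map α))

@[simp] theorem lin_comp (f : X ⟶ Y) (g : Y ⟶ Z) (v : V) (x : space X v) :
    lin (f ≫ g) v x = lin g v (lin f v x) := rfl

@[simp] theorem lin_id (v : V) (x : space X v) : lin (𝟙 X) v x = x := rfl

@[simp] theorem lin_smul (c : k) (f : X ⟶ Y) (v : V) (x : space X v) :
    lin (c • f) v x = c • lin f v x := rfl

theorem lin_ext {f g : X ⟶ Y} (h : ∀ v x, lin f v x = lin g v x) : f = g := by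
  apply NatTrans.ext
  funext v
  apply FGModuleCat.hom_ext
  ext x
  exact h v x

/-- A morphism of representations from a family of linear maps that is natural for arrows. -/
def homMk (f : ∀ v, space X v →ₗ[k] space Y v)
    (hf : ∀ {s t : V} (α : s ⟶ t) (x : space X s), f t (act X α x) = act Y α (f s x)) :
    X ⟶ Y :=
  let φ (v : Paths V) : X.obj v ⟶ Y.obj v := InducedCategory.homMk (ModuleCat.ofHom (f v))
  { app := φ
    naturality := by
      intro a b p
      induction p using Paths.induction with
      | id => rw [X.map_id, Y.map_id, Category.id_comp, Category.comp_id]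
      | comp p q hp =>
        have hq : X.map ((Paths.of V).map q) ≫ φ _ = φ _ ≫ Y.map ((Paths.of V).map q) := by
          apply FGModuleCat.hom_ext
          ext x
          exact hf q x
        rw [Functor.map_comp, Functor.map_comp, Category.assoc, hq, ← Category.assoc, hp,
          Category.assoc] }

@[simp] theorem lin_homMk (f : ∀ v, space X v →ₗ[k] space Y v)
    (hf : ∀ {s t : V} (α : s ⟶ t) (x : space X s), f t (act X α x) = act Y α (f s x))
    (v : V) (x : space X v) : lin (homMk f hf) v x = f v x := rfl

/-- A representation from its spaces and its linear maps. -/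
def mk (S : V → Type u) [∀ v, AddCommGroup (S v)] [∀ v, Module k (S v)]
    [∀ v, Module.Finite k (S v)] (m : ∀ {s t : V}, (s ⟶ t) → (S s →ₗ[k] S t)) :
    QuiverRep k V :=
  Paths.lift { obj := fun v => FGModuleCat.of k (S v), map := fun α => FGModuleCat.ofHom (m α) }

theorem act_mk (S : V → Type u) [∀ v, AddCommGroup (S v)] [∀ v, Module k (S v)]
    [∀ v, Module.Finite k (S v)] (m : ∀ {s t : V}, (s ⟶ t) → (S s →ₗ[k] S t))
    {s t : V} (α : s ⟶ t) (x : S s) : act (mk S m) α x = m α x := by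
  have := Paths.lift_toPath { obj := fun v => FGModuleCat.of k (S v), map := fun α => FGModuleCat.ofHom (m α) } α
  exact congrArg (fun g => g.hom.hom x) this

theorem epi_of_surjective (f : X ⟶ Y) (h : ∀ v, Function.Surjective (lin f v)) : Epi f where
  left_cancellation _ _ hab := by
    refine lin_ext fun v y => ?_
    obtain ⟨x, rfl⟩ := h v y
    exact congrArg (fun g => lin g v x) hab

theorem mono_of_injective (f : X ⟶ Y) (h : ∀ v, Function.Injective (lin f v)) : Mono f where
  right_cancellation _ _ hab :=
    lin_ext fun v y => h v (congrArg (fun g => lin g v y) hab)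

theorem isZero_iff : IsZero X ↔ ∀ v, Subsingleton (space X v) := by
  rw [IsZero.iff_id_eq_zero]
  constructor
  · intro h v
    refine ⟨fun x y => ?_⟩
    have e : ∀ z, lin (𝟙 X) v z = lin (0 : X ⟶ X) v z := fun z => by rw [h]
    simpa using (e x).trans (e y).symm
  · exact fun h => lin_ext fun v x => Subsingleton.elim _ _

/-- Injectivity of `i` makes preimages of vectors killed by `p` unique, hence linear in the vector
and compatible with the arrows. They assemble to a morphism, so the refinement can be the identity.
-/
theorem shortExact_mk (i : X ⟶ Y) (p : Y ⟶ Z) (w : i ≫ p = 0)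
    (hi : ∀ v, Function.Injective (lin i v)) (hp : ∀ v, Function.Surjective (lin p v))
    (hip : ∀ v y, lin p v y = 0 → ∃ x, lin i v x = y) :
    (ShortComplex.mk i p w).ShortExact := by
  have := mono_of_injective i hi
  have := epi_of_surjective p hp
  refine { exact := ?_ }
  rw [ShortComplex.exact_iff_exact_up_to_refinements]
  intro A y hy
  have hy' : ∀ v a, ∃ x, lin i v x = lin y v a := fun v a =>
    hip v _ (congrArg (fun g => lin g v a) hy)
  choose g hg using hy'
  refine ⟨A, 𝟙 A, inferInstance, homMk (fun v => 
    { toFun := g v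
      map_add' := fun a b => hi v (by simp [hg])
      map_smul' := fun c a => hi v (by simp [hg]) }) (fun α a => hi _ ?_), ?_⟩
  · simp [hg, lin_act]
  · refine lin_ext fun v a => ?_
    simp [hg]

theorem shortExact_exact {i : X ⟶ Y} {p : Y ⟶ Z} {w : i ≫ p = 0}
    (h : (ShortComplex.mk i p w).ShortExact) (v : V) :
    Function.Injective (lin i v) ∧ Function.Exact (lin i v) (lin p v) ∧
      Function.Surjective (lin p v) := by
  have := (inferInstance : ((evaluation (Paths V) (FGModuleCat.{u} k)).obj ((Paths.of V).obj v)).Additive)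
  have h' := (h.map_of_exact ((evaluation (Paths V) (FGModuleCat.{u} k)).obj ((Paths.of V).obj v))).map_of_exact
    (forget₂ (FGModuleCat.{u} k) (ModuleCat.{u} k))
  exact ⟨h'.moduleCat_injective_f, (ShortComplex.ShortExact.moduleCat_exact_iff_function_exact _).1 h'.exact, h'.moduleCat_surjective_g⟩

theorem finrank_of_shortExact {i : X ⟶ Y} {p : Y ⟶ Z} {w : i ≫ p = 0}
    (h : (ShortComplex.mk i p w).ShortExact) (v : V) :
    Module.finrank k (space Y v) = Module.finrank k (space X v) + Module.finrank k (space Z v) := by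
  obtain ⟨h1, h2, h3⟩ := shortExact_exact h v
  have := LinearMap.finrank_range_add_finrank_ker (lin p v)
  rw [LinearMap.range_eq_top.2 h3, finrank_top, LinearMap.exact_iff.1 h2, LinearMap.finrank_range_of_inj h1] at this
  omega

/-- Isomorphic representations have isomorphic spaces. -/
def spaceEquiv (e : X ≅ Y) (v : V) : space X v ≃ₗ[k] space Y v :=
  LinearEquiv.ofLinearMap (lin e.hom v) (lin e.inv v)
    (by ext x; simp [← lin_comp]) (by ext x; simp [← lin_comp])

end Basic

end QuiverRep

namespace QuiverRep

/-! ### Thin representations and bricks -/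

section Thin

/-- The subspace of `k` that is everything if `p` holds and zero otherwise. -/
def thinSpace (k : Type u) [Field k] (p : Prop) : Submodule k k where
  carrier := {x | ¬ p → x = 0}
  add_mem' ha hb h := by rw [ha h, hb h, add_zero]
  zero_mem' _ := rfl
  smul_mem' c x hx h := by rw [hx h, smul_zero]

open scoped Classical in
/-- The map between `0` or `k` and `0` or `k` that is the identity whenever possible. -/
noncomputable def thinMap (k : Type u) [Field k] (p q : Prop) :
    thinSpace k p →ₗ[k] thinSpace k q where
  toFun x := ⟨if q then x.1 else 0, fun h => if_neg h⟩
  map_add' x y := by ext; by_cases q <;> simp [*]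
  map_smul' c x := by ext; by_cases q <;> simp [*]

variable {k : Type u} [Field k] {V : Type} [Quiver.{0} V]

variable (k) in
/-- The thin representation supported on the vertices with `P`: one-dimensional there, with
identity maps. -/
noncomputable def thin (P : V → Prop) : QuiverRep k V :=
  mk (fun v => thinSpace k (P v)) (fun {s t} _ => thinMap k (P s) (P t))

variable {P Q : V → Prop} {X : QuiverRep k V}

/-- The coordinate on the space of a thin representation. -/
def coord (P : V → Prop) (v : V) : space (thin k P) v →ₗ[k] k := (thinSpace k (P v)).subtype

open scoped Classical in
/-- The vector with a given coordinate (zero outside of the support). -/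
noncomputable def pt (P : V → Prop) (v : V) (c : k) : space (thin k P) v :=
  (⟨if P v then c else 0, fun h => if_neg h⟩ : thinSpace k (P v))

theorem coord_injective (v : V) : Function.Injective (coord (k := k) P v) :=
  Subtype.val_injective

theorem coord_eq_zero {v : V} (h : ¬ P v) (x : space (thin k P) v) : coord P v x = 0 :=
  Subtype.property (p := (· ∈ thinSpace k (P v))) x h

theorem thin_eq_zero {v : V} (h : ¬ P v) (x : space (thin k P) v) : x = 0 :=
  coord_injective v (by rw [coord_eq_zero h, map_zero])

theorem coord_pt {v : V} (h : P v) (c : k) : coord P v (pt P v c) = c := if_pos h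

@[simp] theorem pt_coord (v : V) (x : space (thin k P) v) : pt P v (coord P v x) = x := by
  by_cases h : P v
  · exact coord_injective v (coord_pt h _)
  · rw [thin_eq_zero h (pt P v _), thin_eq_zero h x]

theorem coord_act {s t : V} (α : s ⟶ t) (h : P t) (x : space (thin k P) s) :
    coord P t (act (thin k P) α x) = coord P s x :=
  (congrArg (coord P t) (act_mk (fun v => thinSpace k (P v))
    (fun {s t} _ => thinMap k (P s) (P t)) α x)).trans (if_pos h)

theorem act_pt {s t : V} (α : s ⟶ t) (h : P s) (c : k) :
    act (thin k P) α (pt P s c) = pt P t c := by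
  by_cases ht : P t
  · exact coord_injective t (by rw [coord_act α ht, coord_pt h, coord_pt ht])
  · rw [thin_eq_zero ht (act _ _ _), thin_eq_zero ht (pt P t c)]

theorem finrank_thin_le (v : V) : Module.finrank k (space (thin k P) v) ≤ 1 :=
  (LinearMap.finrank_le_finrank_of_injective (coord_injective v)).trans (Module.finrank_self k).le

theorem finrank_thin {v : V} (h : P v) : Module.finrank k (space (thin k P) v) = 1 :=
  (LinearEquiv.finrank_eq (LinearEquiv.ofBijective (coord P v)
    ⟨coord_injective v, fun c => ⟨pt P v c, coord_pt h c⟩⟩)).trans (Module.finrank_self k)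

/-- A compatible family of vectors is a morphism from a thin representation. -/
noncomputable def fromThin (x : ∀ v, space X v) (hx : ∀ v, ¬ P v → x v = 0)
    (h : ∀ {s t : V} (α : s ⟶ t), P s → act X α (x s) = x t) : thin k P ⟶ X :=
  homMk (fun v => (coord P v).smulRight (x v)) fun {s t} α c => by
    by_cases hs : P s
    · by_cases ht : P t
      · simp [coord_act α ht, h α hs]
      · simp [h α hs, hx t ht]
    · simp [thin_eq_zero hs c]

theorem lin_fromThin (x : ∀ v, space X v) (hx : ∀ v, ¬ P v → x v = 0)
    (h : ∀ {s t : V} (α : s ⟶ t), P s → act X α (x s) = x t) (v : V) (c : space (thin k P) v) :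
    lin (fromThin x hx h) v c = coord P v c • x v := rfl

/-- A compatible family of linear forms is a morphism to a thin representation. -/
noncomputable def toThin (φ : ∀ v, space X v →ₗ[k] k) (hφ : ∀ v, ¬ P v → φ v = 0)
    (h : ∀ {s t : V} (α : s ⟶ t), P t → ∀ x, φ t (act X α x) = φ s x) : X ⟶ thin k P :=
  homMk (fun v => (φ v).codRestrict (thinSpace k (P v)) fun x hv => by rw [hφ v hv]; rfl)
    fun {s t} α x => by
      by_cases ht : P t
      · refine coord_injective t ?_
        rw [coord_act α ht]
        exact h α ht x
      · rw [thin_eq_zero ht (act _ _ _)]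
        exact thin_eq_zero ht _

theorem coord_toThin (φ : ∀ v, space X v →ₗ[k] k) (hφ : ∀ v, ¬ P v → φ v = 0)
    (h : ∀ {s t : V} (α : s ⟶ t), P t → ∀ x, φ t (act X α x) = φ s x) (v : V) (x : space X v) :
    coord P v (lin (toThin φ hφ h) v x) = φ v x := rfl

theorem lin_pt_eq_smul {f : thin k P ⟶ X} (v : V) (c : k) :
    lin f v (pt P v c) = c • lin f v (pt P v 1) := by
  rw [← map_smul]
  congr 1
  by_cases h : P v
  · exact coord_injective v (by simp [coord_pt h])
  · rw [thin_eq_zero h (pt P v c), thin_eq_zero h (_ • _)]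

/-- The support `P` is nonempty and connected (tested with functions to `k`). -/
def ConnectedSupport (k : Type u) (P : V → Prop) : Prop :=
  (∃ v, P v) ∧ ∀ c : V → k, (∀ {s t : V} (_ : s ⟶ t), P s → P t → c s = c t) →
    ∀ v w, P v → P w → c v = c w

/-- A nonzero representation all of whose endomorphisms are scalars. -/
def IsBrick (X : QuiverRep k V) : Prop := ¬ IsZero X ∧ ∀ f : X ⟶ X, ∃ c : k, f = c • 𝟙 X

/-- An endomorphism is a scalar at each vertex of the support, and naturality makes the scalars at
the two ends of an arrow equal. -/
theorem isBrick_thin (hP : ConnectedSupport k P) : IsBrick (thin k P) := by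
  obtain ⟨⟨v₀, h₀⟩, hc⟩ := hP
  refine ⟨fun hz => ?_, fun f => ⟨coord P v₀ (lin f v₀ (pt P v₀ 1)), lin_ext fun v x => ?_⟩⟩
  · have := isZero_iff.1 hz v₀
    have := congrArg (coord P v₀) (Subsingleton.elim (pt P v₀ (1 : k)) 0)
    rw [coord_pt h₀, map_zero] at this
    exact one_ne_zero this
  · by_cases hv : P v
    · have := hc (fun v => coord P v (lin f v (pt P v 1))) (fun {s t} α hs ht => by
        rw [← coord_act α ht, ← lin_act, act_pt α hs]) v₀ v h₀ hv
      rw [this]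
      refine coord_injective v ?_
      conv_lhs => rw [← pt_coord v x, lin_pt_eq_smul]
      simp [mul_comm]
    · rw [thin_eq_zero hv x, map_zero, map_zero]

theorem smul_id_ne_zero (hX : ¬ IsZero X) {c : k} (h : c • 𝟙 X = 0) : c = 0 := by
  by_contra hc
  exact hX ((IsZero.iff_id_eq_zero _).2 (by simpa [hc] using h))

/-- Both composites are scalars. At a vertex of `P` outside `Q` the scalar of `f ≫ g` is visibly
zero. At a vertex of `Q` outside `P` it is `g ≫ f` that vanishes, and then `f ≫ g` squares to zero.
-/
theorem thin_comp_eq_zero (hP : ConnectedSupport k P) (hQ : ConnectedSupport k Q) {v : V}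
    (hv : ¬ (P v ↔ Q v)) (f : thin k P ⟶ thin k Q) (g : thin k Q ⟶ thin k P) : f ≫ g = 0 := by
  obtain ⟨c, hc⟩ := (isBrick_thin hP).2 (f ≫ g)
  obtain ⟨d, hd⟩ := (isBrick_thin hQ).2 (g ≫ f)
  by_cases hPv : P v
  · have hQv : ¬ Q v := fun h => hv ⟨fun _ => h, fun _ => hPv⟩
    have := congrArg (fun e => coord P v (lin e v (pt P v 1))) hc
    simp only [lin_comp, thin_eq_zero hQv (lin f v _), map_zero, lin_smul, lin_id, map_smul,
      coord_pt hPv, smul_eq_mul, mul_one] at this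
    rw [hc, ← this, zero_smul]
  · have hQv : Q v := by tauto
    have := congrArg (fun e => coord Q v (lin e v (pt Q v 1))) hd
    simp only [lin_comp, thin_eq_zero hPv (lin g v _), map_zero, lin_smul, lin_id, map_smul,
      coord_pt hQv, smul_eq_mul, mul_one] at this
    rw [← this, zero_smul] at hd
    have h2 : (f ≫ g) ≫ (f ≫ g) = 0 := by
      rw [Category.assoc, ← Category.assoc g, hd, zero_comp, comp_zero]
    have : (c * c) • 𝟙 (thin k P) = 0 := by
      rw [hc] at h2
      simpa [smul_smul] using h2
    have := smul_id_ne_zero (isBrick_thin hP).1 this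
    rw [hc, mul_self_eq_zero.1 this, zero_smul]

/-- The idempotent projecting to one summand is a scalar: if it is zero that summand vanishes,
otherwise the complement does. -/
theorem IsBrick.indecomposable (h : IsBrick X) : Indecomposable X := by
  refine ⟨h.1, fun Y Z e => ?_⟩
  obtain ⟨c, hc⟩ := h.2 (e.hom ≫ biprod.fst ≫ biprod.inl ≫ e.inv)
  by_cases h0 : c = 0
  · left
    rw [IsZero.iff_id_eq_zero]
    have : 𝟙 Y = biprod.inl ≫ e.inv ≫ (e.hom ≫ biprod.fst ≫ biprod.inl ≫ e.inv) ≫ e.hom ≫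
      biprod.fst := by simp
    rw [this, hc, h0]
    simp
  · right
    rw [IsZero.iff_id_eq_zero]
    have : c • 𝟙 Z = biprod.inr ≫ e.inv ≫ (c • 𝟙 X) ≫ e.hom ≫ biprod.snd := by simp
    rw [← hc] at this
    have h2 : c • 𝟙 Z = 0 := by simpa using this
    exact (smul_eq_zero.1 h2).resolve_left h0

end Thin

end QuiverRep

namespace QuiverRep

/-! ### Decompositions into bricks and their uniqueness -/

section KrullSchmidt

variable {k : Type u} [Field k] {V : Type} [Quiver.{0} V] {X Y A B T T' : QuiverRep k V}

theorem isSummand_iff : IsSummand A T ↔ ∃ (a : A ⟶ T) (p : T ⟶ A), a ≫ p = 𝟙 A := by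
  constructor
  · rintro ⟨B, ⟨e⟩⟩
    exact ⟨biprod.inl ≫ e.inv, e.hom ≫ biprod.fst, by simp⟩
  · rintro ⟨a, p, h⟩
    have : IsSplitEpi p := ⟨⟨a, h⟩⟩
    have hS := ShortComplex.Splitting.ofExactOfSection
      (ShortComplex.mk (kernel.ι p) p (kernel.condition p)) (ShortComplex.exact_kernel p) a h
      inferInstance
    exact ⟨_, ⟨hS.isoBinaryBiproduct ≪≫ biprod.braiding _ _⟩⟩

theorem IsSummand.trans (h : IsSummand A B) (h' : IsSummand B T) : IsSummand A T := by
  rw [isSummand_iff] at *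
  obtain ⟨a, p, h⟩ := h
  obtain ⟨a', p', h'⟩ := h'
  exact ⟨a ≫ a', p' ≫ p, by rw [Category.assoc, reassoc_of% h', h]⟩

theorem isSummand_of_iso (e : A ≅ T) : IsSummand A T :=
  isSummand_iff.2 ⟨e.hom, e.inv, e.hom_inv_id⟩

theorem isSummand_inl : IsSummand A (A ⊞ B) := ⟨B, ⟨Iso.refl _⟩⟩

theorem isSummand_inr : IsSummand B (A ⊞ B) := ⟨A, ⟨biprod.braiding _ _⟩⟩

theorem IsSummand.biprod (h : IsSummand A T) (h' : IsSummand B T') :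
    IsSummand (A ⊞ B) (T ⊞ T') := by
  rw [isSummand_iff] at *
  obtain ⟨a, p, h⟩ := h
  obtain ⟨a', p', h'⟩ := h'
  exact ⟨biprod.map a a', biprod.map p p', by
    apply biprod.hom_ext' <;> apply biprod.hom_ext <;> simp [reassoc_of% h, reassoc_of% h']⟩

theorem finrank_biprod (v : V) : Module.finrank k (space (A ⊞ B) v) =
    Module.finrank k (space A v) + Module.finrank k (space B v) :=
  finrank_of_shortExact (ShortComplex.Splitting.ofHasBinaryBiproduct A B).shortExact v

/-- Adding one summand to a direct sum. -/
noncomputable def biproductOptionIso {J : Type} [Finite J] (F : Option J → QuiverRep k V) :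
    F none ⊞ (⨁ fun j => F (some j)) ≅ ⨁ F where
  hom := biprod.desc (biproduct.ι F none) (biproduct.desc fun j => biproduct.ι F (some j))
  inv := biproduct.desc fun o => match o with
    | none => biprod.inl
    | some j => biproduct.ι (fun j => F (some j)) j ≫ biprod.inr
  hom_inv_id := by
    apply biprod.hom_ext'
    · simp
    · apply biproduct.hom_ext'
      simp
  inv_hom_id := by
    apply biproduct.hom_ext'
    rintro (_ | j) <;> simp

theorem comp_eq_sum {J : Type} [Fintype J] {F : J → QuiverRep k V} (f : X ⟶ ⨁ F)
    (g : ⨁ F ⟶ Y) : f ≫ g = ∑ j, (f ≫ biproduct.π F j) ≫ biproduct.ι F j ≫ g := by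
  conv_lhs => rw [← Category.id_comp g, ← biproduct.total, Preadditive.sum_comp,
    Preadditive.comp_sum]
  simp only [Category.assoc]

/-- Bricks without nonzero maps back and forth, one of which is a summand of every nonzero
representation. -/
structure IsBrickSystem {I : Type} (M : I → QuiverRep k V) : Prop where
  isBrick : ∀ i, IsBrick (M i)
  comp_eq_zero : ∀ {i j}, i ≠ j → ∀ (f : M i ⟶ M j) (g : M j ⟶ M i), f ≫ g = 0
  exists_isSummand : ∀ X : QuiverRep k V, ¬ IsZero X → ∃ i, IsSummand (M i) X

namespace IsBrickSystem

variable {I : Type} {M : I → QuiverRep k V} (hM : IsBrickSystem M)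
include hM

theorem exists_iso (hX : Indecomposable X) : ∃ i, Nonempty (X ≅ M i) := by
  obtain ⟨i, B, ⟨e⟩⟩ := hM.exists_isSummand X hX.1
  have hB := (hX.2 _ _ e).resolve_left (hM.isBrick i).1
  exact ⟨i, ⟨e ≪≫ ⟨biprod.fst, biprod.inl, by
    apply biprod.hom_ext
    · simp
    · exact hB.eq_of_tgt _ _, by simp⟩⟩⟩

theorem exists_decomposition [Fintype V] (T : QuiverRep k V) :
    ∃ (J : Type) (_ : Finite J) (σ : J → I), Nonempty (T ≅ ⨁ fun j => M (σ j)) := by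
  induction h : ∑ v, Module.finrank k (space T v) using Nat.strong_induction_on generalizing T with
  | _ d ih =>
    by_cases hT : IsZero T
    · refine ⟨Empty, inferInstance, Empty.elim, ⟨hT.iso ?_⟩⟩
      rw [IsZero.iff_id_eq_zero]
      exact biproduct.hom_ext _ _ (fun j => j.elim)
    · obtain ⟨i, B, ⟨e⟩⟩ := hM.exists_isSummand T hT
      obtain ⟨J, hJ, σ, ⟨e'⟩⟩ := ih (∑ v, Module.finrank k (space B v)) (by
        rw [← h]
        apply Finset.sum_lt_sum
        · intro v _
          rw [LinearEquiv.finrank_eq (spaceEquiv e v), finrank_biprod]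
          omega
        · have := (hM.isBrick i).1
          rw [isZero_iff] at this
          push Not at this
          obtain ⟨v, hv⟩ := this
          refine ⟨v, Finset.mem_univ v, ?_⟩
          rw [LinearEquiv.finrank_eq (spaceEquiv e v), finrank_biprod]
          have := Module.finrank_pos (R := k) (M := space (M i) v)
          omega) B rfl
      exact ⟨Option J, inferInstance, fun o => o.elim i σ,
        ⟨e ≪≫ biprod.mapIso (Iso.refl _) e' ≪≫
          biproductOptionIso (fun o : Option J => M (o.elim i σ))⟩⟩

variable {J : Type} [Finite J] {σ : J → I}

/-- Endomorphisms of `M i` through the sum factor through the only component equal to `M i`, the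
others contributing zero. Two copies would thus both have to embed in a one-dimensional space of
scalars: s and t would be nonzero with t * s = 0. -/
theorem not_isSummand_biprod_self (hσ : Function.Injective σ) (i : I) :
    ¬ IsSummand (M i ⊞ M i) (⨁ fun j => M (σ j)) := by
  have := Fintype.ofFinite J
  rw [isSummand_iff]
  rintro ⟨a, p, h⟩
  have hne : 𝟙 (M i) ≠ 0 := fun h0 => (hM.isBrick i).1 ((IsZero.iff_id_eq_zero _).2 h0)
  have h11 : (biprod.inl ≫ a) ≫ p ≫ biprod.fst = 𝟙 (M i) := by simp [reassoc_of% h]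
  have h22 : (biprod.inr ≫ a) ≫ p ≫ biprod.snd = 𝟙 (M i) := by simp [reassoc_of% h]
  have h12 : (biprod.inl ≫ a) ≫ p ≫ biprod.snd = 0 := by simp [reassoc_of% h]
  by_cases hi : ∃ j, σ j = i
  · obtain ⟨j, rfl⟩ := hi
    have key' (f : M (σ j) ⟶ ⨁ fun j => M (σ j)) (g : (⨁ fun j => M (σ j)) ⟶ M (σ j)) :
        f ≫ g = (f ≫ biproduct.π _ j) ≫ biproduct.ι (fun j => M (σ j)) j ≫ g := by
      rw [comp_eq_sum, Finset.sum_eq_single j]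
      · exact fun j' _ hj => hM.comp_eq_zero (fun e => hj (hσ e).symm) _ _
      · simp
    rw [key'] at h11 h12 h22
    obtain ⟨s, hs⟩ := (hM.isBrick (σ j)).2 ((biprod.inl ≫ a) ≫ biproduct.π _ j)
    obtain ⟨t, ht⟩ := (hM.isBrick (σ j)).2
      (biproduct.ι (fun j => M (σ j)) j ≫ p ≫ biprod.snd)
    rw [hs] at h11 h12
    rw [ht] at h12 h22
    have h0 : t • s • 𝟙 (M (σ j)) = 0 := by simpa using h12
    rcases smul_eq_zero.1 h0 with h0 | h0
    · exact hne (by simpa [h0] using h22.symm)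
    · exact hne (by simpa [h0] using h11.symm)
  · push Not at hi
    refine hne ?_
    rw [← h11, comp_eq_sum]
    exact Finset.sum_eq_zero fun j _ => hM.comp_eq_zero (hi j).symm _ _

theorem isSummand_biproduct_iff (i : I) :
    IsSummand (M i) (⨁ fun j => M (σ j)) ↔ ∃ j, σ j = i := by
  have := Fintype.ofFinite J
  constructor
  · rw [isSummand_iff]
    rintro ⟨a, p, h⟩
    by_contra! hi
    refine (hM.isBrick i).1 ((IsZero.iff_id_eq_zero _).2 ?_)
    rw [← h, comp_eq_sum]
    exact Finset.sum_eq_zero fun j _ => hM.comp_eq_zero (hi j).symm _ _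
  · rintro ⟨j, rfl⟩
    exact isSummand_iff.2 ⟨biproduct.ι (fun j => M (σ j)) j, biproduct.π _ j,
      biproduct.ι_π_self _ _⟩

omit hM in
theorem isSummand_biprod_self {j₁ j₂ : J} (hj : j₁ ≠ j₂) (h : σ j₁ = σ j₂) :
    IsSummand (M (σ j₁) ⊞ M (σ j₁)) (⨁ fun j => M (σ j)) := by
  classical
  refine IsSummand.trans (B := M (σ j₁) ⊞ M (σ j₂))
    (isSummand_of_iso (biprod.mapIso (Iso.refl _) (eqToIso (by rw [h])))) (isSummand_iff.2
    ⟨biprod.desc (biproduct.ι (fun j => M (σ j)) j₁) (biproduct.ι (fun j => M (σ j)) j₂),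
      biprod.lift (biproduct.π _ j₁) (biproduct.π _ j₂), ?_⟩)
  apply biprod.hom_ext' <;> apply biprod.hom_ext <;>
    simp [biproduct.ι_π_ne _ hj, biproduct.ι_π_ne _ hj.symm]

theorem isBasic_iff_injective (e : T ≅ ⨁ fun j => M (σ j)) :
    IsBasic T ↔ Function.Injective σ := by
  constructor
  · intro h j₁ j₂ hj
    by_contra hne
    exact h _ (hM.isBrick (σ j₁)).indecomposable
      ((isSummand_biprod_self hne hj).trans (isSummand_of_iso e.symm))
  · intro hσ A hA hs
    obtain ⟨i, ⟨f⟩⟩ := hM.exists_iso hA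
    exact hM.not_isSummand_biprod_self hσ i
      (((isSummand_of_iso (biprod.mapIso f.symm f.symm)).trans hs).trans (isSummand_of_iso e))

end IsBrickSystem

end KrullSchmidt

end QuiverRep

/-- A set of pairwise related elements that contains every element related to all of it. -/
def IsMaximalClique {I : Type} (R : I → I → Prop) (S : Set I) : Prop :=
  (∀ i ∈ S, ∀ j ∈ S, R i j) ∧ ∀ i, (∀ j ∈ S, R i j) → i ∈ S

namespace QuiverRep

/-! ### Maximal almost rigid representations as maximal cliques -/

section Correspondence

variable {k : Type u} [Field k] {V : Type} [Quiver.{0} V] {T : QuiverRep k V}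

/-- The condition on `Ext(A, B)` for a pair of summands of an almost rigid representation. -/
def IsExtAdmissible (A B : QuiverRep k V) : Prop :=
  Subsingleton (Ext.{u + 1} A B 1) ∨ ExtGeneratedByIndecomposable A B

/-- The relation `R` on a brick system says that the `Ext` conditions hold in both directions. -/
structure IsCompatibility {I : Type} (M : I → QuiverRep k V) (R : I → I → Prop) : Prop where
  refl : ∀ i, R i i
  symm : ∀ {i j}, R i j → R j i
  isExtAdmissible : ∀ {i j}, R i j → ∀ {A B}, (A ≅ M i) → (B ≅ M j) → IsExtAdmissible A B
  of_isExtAdmissible : ∀ {i j}, IsExtAdmissible (M i) (M j) → IsExtAdmissible (M j) (M i) → R i j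

namespace IsBrickSystem

variable {I : Type} {M : I → QuiverRep k V} (hM : IsBrickSystem M) {R : I → I → Prop}
  (hR : IsCompatibility M R)
include hM hR

theorem isAlmostRigid_iff : IsAlmostRigid T ↔
    IsBasic T ∧ ∀ i j, IsSummand (M i) T → IsSummand (M j) T → R i j := by
  refine and_congr_right fun _ => ⟨fun h i j hi hj => ?_, fun h A B hA hB hAT hBT => ?_⟩
  · exact hR.of_isExtAdmissible
      (h _ _ (hM.isBrick i).indecomposable (hM.isBrick j).indecomposable hi hj)
      (h _ _ (hM.isBrick j).indecomposable (hM.isBrick i).indecomposable hj hi)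
  · obtain ⟨i, ⟨e⟩⟩ := hM.exists_iso hA
    obtain ⟨j, ⟨f⟩⟩ := hM.exists_iso hB
    exact hR.isExtAdmissible (h i j ((isSummand_of_iso e.symm).trans hAT)
      ((isSummand_of_iso f.symm).trans hBT)) e f

variable {J : Type} [Finite J] {σ : J → I}

theorem isAlmostRigid_iff_of_iso (e : T ≅ ⨁ fun j => M (σ j)) :
    IsAlmostRigid T ↔ Function.Injective σ ∧ ∀ a b, R (σ a) (σ b) := by
  have hs (i : I) : IsSummand (M i) T ↔ ∃ j, σ j = i :=
    ⟨fun h => (hM.isSummand_biproduct_iff i).1 (h.trans (isSummand_of_iso e)),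
      fun h => ((hM.isSummand_biproduct_iff i).2 h).trans (isSummand_of_iso e.symm)⟩
  rw [hM.isAlmostRigid_iff hR, hM.isBasic_iff_injective e]
  simp only [hs]
  refine and_congr_right fun _ => ⟨fun h a b => h _ _ ⟨a, rfl⟩ ⟨b, rfl⟩, ?_⟩
  rintro h _ _ ⟨a, rfl⟩ ⟨b, rfl⟩
  exact h a b

/-- It suffices to test adding a single `M i`, since every nonzero representation has one as a
summand. A new compatible index could be added to `T`; an index already present would produce a
repeated summand. -/
theorem isMaximalAlmostRigid_iff (e : T ≅ ⨁ fun j => M (σ j)) :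
    IsMaximalAlmostRigid T ↔ Function.Injective σ ∧ IsMaximalClique R (Set.range σ) := by
  constructor
  · rintro ⟨h, hmax⟩
    obtain ⟨hσ, hc⟩ := (hM.isAlmostRigid_iff_of_iso hR e).1 h
    refine ⟨hσ, ?_, fun i hi => ?_⟩
    · rintro _ ⟨a, rfl⟩ _ ⟨b, rfl⟩
      exact hc a b
    · by_contra hn
      refine hmax (M i) (hM.isBrick i).1 ((hM.isAlmostRigid_iff_of_iso hR
        (biprod.braiding _ _ ≪≫ biprod.mapIso (Iso.refl _) e ≪≫
          biproductOptionIso (fun o : Option J => M (o.elim i σ)))).2 ⟨?_, ?_⟩)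
      · rintro (_ | a) (_ | b) hab
        · rfl
        · exact absurd ⟨b, hab.symm⟩ hn
        · exact absurd ⟨a, hab⟩ hn
        · exact congrArg some (hσ hab)
      · rintro (_ | a) (_ | b)
        · exact hR.refl i
        · exact hi _ ⟨b, rfl⟩
        · exact hR.symm (hi _ ⟨a, rfl⟩)
        · exact hc a b
  · rintro ⟨hσ, hc, hmax⟩
    refine ⟨(hM.isAlmostRigid_iff_of_iso hR e).2 ⟨hσ, fun a b => hc _ ⟨a, rfl⟩ _ ⟨b, rfl⟩⟩,
      fun N hN hT => ?_⟩
    obtain ⟨i, hi⟩ := hM.exists_isSummand N hN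
    obtain ⟨hb, hT⟩ := (hM.isAlmostRigid_iff hR).1 hT
    have hsub (j : J) : IsSummand (M (σ j)) T :=
      ((hM.isSummand_biproduct_iff _).2 ⟨j, rfl⟩).trans (isSummand_of_iso e.symm)
    obtain ⟨j, rfl⟩ := hmax i (by
      rintro _ ⟨j, rfl⟩
      exact hT _ _ (hi.trans isSummand_inr) ((hsub j).trans isSummand_inl))
    exact hb _ (hM.isBrick (σ j)).indecomposable ((hsub j).biprod hi)

theorem isSumOfIndecomposables_iff [Fintype V] (hT : IsMaximalAlmostRigid T) :
    ∃ S : Set I, IsMaximalClique R S ∧ ∀ m, IsSumOfIndecomposables T m ↔ m = S.ncard := by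
  obtain ⟨J, hJ, σ, ⟨e⟩⟩ := hM.exists_decomposition T
  obtain ⟨hσ, hc⟩ := (hM.isMaximalAlmostRigid_iff hR e).1 hT
  have hcard : (Set.range σ).ncard = Nat.card J := by
    rw [← Nat.card_coe_set_eq, Nat.card_range_of_injective hσ]
  refine ⟨_, hc, fun m => ⟨?_, ?_⟩⟩
  · rintro ⟨N, hN, ⟨f⟩⟩
    choose τ hτ using fun i => hM.exists_iso (hN i)
    have f' : T ≅ ⨁ fun j => M (τ j) := f ≪≫ biproduct.mapIso fun i => (hτ i).some
    have hτ' := ((hM.isMaximalAlmostRigid_iff hR f').1 hT).1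
    -- Both ranges are the set of all i such that `M i` is a summand of `T`, which depends only on
    -- the isomorphism class.
    have : Set.range σ = Set.range τ := by
      ext i
      refine (hM.isSummand_biproduct_iff (σ := σ) i).symm.trans
        (Iff.trans ?_ (hM.isSummand_biproduct_iff (σ := τ) i))
      exact ⟨fun h => h.trans (isSummand_of_iso (e.symm ≪≫ f')),
        fun h => h.trans (isSummand_of_iso (f'.symm ≪≫ e))⟩
    rw [this, ← Nat.card_coe_set_eq, Nat.card_range_of_injective hτ', Nat.card_fin]
  · rw [hcard]
    rintro rfl
    refine ⟨fun i => M (σ ((Finite.equivFin J).symm i)),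
      fun i => (hM.isBrick _).indecomposable,
      ⟨e ≪≫ biproduct.whiskerEquiv (Finite.equivFin J) fun j => eqToIso (by simp)⟩⟩

theorem card_mar [Fintype V] [Finite I] :
    Nat.card (mar k V) = Nat.card {S : Set I // IsMaximalClique R S} := by
  classical
  have hS (S : {S : Set I // IsMaximalClique R S}) :
      IsMaximalAlmostRigid (⨁ fun j : S.1 => M j.1) :=
    (hM.isMaximalAlmostRigid_iff hR (σ := fun j : S.1 => j.1) (Iso.refl _)).2
      ⟨Subtype.val_injective, by rw [Subtype.range_coe]; exact S.2⟩
  refine (Nat.card_congr (Equiv.ofBijective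
    (fun S => (⟨_, _, hS S, rfl⟩ : mar k V)) ⟨fun S S' h => ?_, ?_⟩)).symm
  · obtain ⟨e⟩ : Nonempty ((⨁ fun j : S.1 => M j.1) ≅ ⨁ fun j : S'.1 => M j.1) :=
      Quotient.exact (congrArg Subtype.val h)
    ext i
    have h1 := hM.isSummand_biproduct_iff (σ := fun j : S.1 => j.1) i
    have h2 := hM.isSummand_biproduct_iff (σ := fun j : S'.1 => j.1) i
    simp only [Subtype.exists, exists_prop, exists_eq_right] at h1 h2
    rw [← h1, ← h2]
    exact ⟨fun h => h.trans (isSummand_of_iso e), fun h => h.trans (isSummand_of_iso e.symm)⟩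
  · rintro ⟨_, T, hT, rfl⟩
    obtain ⟨J, hJ, σ, ⟨e⟩⟩ := hM.exists_decomposition T
    obtain ⟨hσ, hc⟩ := (hM.isMaximalAlmostRigid_iff hR e).1 hT
    refine ⟨⟨_, hc⟩, Subtype.ext (Quotient.sound ⟨?_⟩)⟩
    exact (e ≪≫ biproduct.whiskerEquiv (f := fun j => M (σ j)) (g := fun j => M j.1)
      (Equiv.ofInjective σ hσ) fun j => Iso.refl _).symm

end IsBrickSystem

end Correspondence

end QuiverRep

/-! ### Killing Ext classes by epimorphisms -/

section Effaceable

universe w v u'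

open HomologicalComplex DerivedCategory

variable {C : Type u'} [Category.{v} C] [Abelian C]

/-- As `K` ends in degree i, its top term surjects onto the top homology, which is `A`. The
differential leaving that term is zero, so the term alone in degree i maps to `K` as a complex. -/
theorem exists_epi_single_map_eq {K : CochainComplex C ℤ} {A : C} {i : ℤ} [K.IsStrictlyLE i]
    (π : K ⟶ (single C (ComplexShape.up ℤ) i).obj A) [QuasiIsoAt π i] :
    ∃ (α : K.X i ⟶ A) (ζ : (single C (ComplexShape.up ℤ) i).obj (K.X i) ⟶ K),
      Epi α ∧ ζ ≫ π = (single C (ComplexShape.up ℤ) i).map α := by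
  have hd : K.d i (i + 1) = 0 := (K.isZero_of_isStrictlyLE i (i + 1) (by simp)).eq_of_tgt _ _
  let e := K.iCyclesIso i (i + 1) (by simp) hd
  let α := e.inv ≫ K.homologyπ i ≫ homologyMap π i ≫ (singleObjHomologySelfIso _ _ _).hom
  have hα : π.f i = α ≫ (singleObjXSelf (ComplexShape.up ℤ) i A).inv := by
    rw [← cancel_epi e.hom]
    dsimp only [α, e]
    rw [Category.assoc, Category.assoc, Category.assoc, Iso.hom_inv_id_assoc,
      homologyπ_naturality_assoc, iCyclesIso_hom,
      homologyπ_singleObjHomologySelfIso_hom_assoc,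
      ← singleObjCyclesSelfIso_inv_iCycles, Iso.hom_inv_id_assoc, ← cyclesMap_i]
  refine ⟨α, mkHomFromSingle (𝟙 _) ?_, ?_, ?_⟩
  · intro j hj
    obtain rfl : i + 1 = j := hj
    rw [hd, comp_zero]
  · exact epi_comp _ _
  · apply HomologicalComplex.from_single_hom_ext
    rw [comp_f, mkHomFromSingle_f, hα, single_map_f_self]
    simp

/-- Represent the morphism by a roof whose apex `K` ends in degree i. Restricted to the top term of
`K`, the second leg is a chain map from degree i to a complex that is zero there. -/
theorem exists_epi_comp_singleFunctor_eq_zero [HasDerivedCategory.{w} C] {A : C}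
    {L : CochainComplex C ℤ} {i : ℤ}
    (φ : Q.obj ((CochainComplex.singleFunctor C i).obj A) ⟶ Q.obj L)
    (n : ℤ) (hn : n < i) [L.IsStrictlyLE n] :
    ∃ (Z : C) (p : Z ⟶ A), Epi p ∧ Q.map ((CochainComplex.singleFunctor C i).map p) ≫ φ = 0 := by
  obtain ⟨K, _, π, h, g, rfl⟩ := right_fac_of_isStrictlyLE φ i
  have hπ : QuasiIso π := by rwa [isIso_Q_map_iff_quasiIso] at h
  have hπ' : QuasiIsoAt π i := hπ.quasiIsoAt i
  obtain ⟨α, ζ, hα, h₁⟩ : ∃ (α : K.X i ⟶ A) (ζ : (CochainComplex.singleFunctor C i).obj (K.X i) ⟶ K),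
      Epi α ∧ ζ ≫ π = (CochainComplex.singleFunctor C i).map α :=
    @exists_epi_single_map_eq _ _ _ K A i _ π hπ'
  have h₂ : ζ ≫ g = 0 := by
    apply HomologicalComplex.from_single_hom_ext
    apply (L.isZero_of_isStrictlyLE n i hn).eq_of_tgt
  refine ⟨K.X i, α, hα, ?_⟩
  rw [← h₁, Q.map_comp, Category.assoc, IsIso.hom_inv_id_assoc, ← Q.map_comp, h₂, Q.map_zero]

/-- Positive degree `Ext` classes are killed by an epimorphism to the first argument. -/
theorem exists_epi_mk₀_comp_eq_zero [HasExt.{w} C] {A B : C} {n : ℕ} (x : Ext A B (n + 1)) :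
    ∃ (Z : C) (p : Z ⟶ A), Epi p ∧ (Ext.mk₀ p).comp x (zero_add _) = 0 := by
  let := HasDerivedCategory.standard C
  obtain ⟨Z, p, hp, h⟩ := exists_epi_comp_singleFunctor_eq_zero
    (L := (CochainComplex.singleFunctor C (-(n + 1))).obj B)
    (Ext.homEquiv x ≫ ((singleFunctors C).shiftIso (n + 1) (-(n + 1)) 0 (by lia)).hom.app _)
    (-(n + 1)) (by lia)
  refine ⟨Z, p, hp, ?_⟩
  ext
  simp only [← cancel_mono (((singleFunctors C).shiftIso (n + 1) (-(n + 1)) 0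
    (by lia)).hom.app _), Limits.zero_comp, Ext.comp_hom, Ext.mk₀_hom, Ext.zero_hom,
    ShiftedHom.mk₀_comp, Category.assoc]
  exact h

end Effaceable

/-! ### Ext in degree one and short exact sequences -/

section ExtOne

universe w v u'

variable {C : Type u'} [Category.{v} C] [Abelian C]

/-- The pushout of a short exact sequence. -/
theorem exists_shortExact_pushout {S : ShortComplex C} (hS : S.ShortExact) {B : C}
    (f : S.X₁ ⟶ B) : ∃ (E : C) (i : B ⟶ E) (p : E ⟶ S.X₃) (w : i ≫ p = 0) (q : S.X₂ ⟶ E),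
      (ShortComplex.mk i p w).ShortExact ∧ f ≫ i = S.f ≫ q ∧ q ≫ p = S.g := by
  have := hS.mono_f
  have := hS.epi_g
  let p : pushout f S.f ⟶ S.X₃ := pushout.desc 0 S.g (by simp)
  have hp : pushout.inr f S.f ≫ p = S.g := pushout.inr_desc _ _ _
  have hp' : pushout.inl f S.f ≫ p = 0 := pushout.inl_desc _ _ _
  have : Epi p := by
    have : Epi (pushout.inr f S.f ≫ p) := by rwa [hp]
    exact epi_of_epi (pushout.inr f S.f) p
  refine ⟨_, pushout.inl f S.f, p, hp', pushout.inr f S.f, ?_, pushout.condition, hp⟩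
  -- A map out of the pushout that vanishes on `B` is a map out of `S.X₂` that vanishes on `S.X₁`,
  -- so it descends to `S.X₃`.
  refine { exact := ShortComplex.exact_of_g_is_cokernel _ (CokernelCofork.IsColimit.ofπ' _ _ ?_) }
  intro W g hg
  have h0 : S.f ≫ pushout.inr f S.f ≫ g = 0 := by
    rw [← pushout.condition_assoc, hg, comp_zero]
  refine ⟨hS.exact.desc (pushout.inr f S.f ≫ g) h0, ?_⟩
  apply pushout.hom_ext
  · rw [reassoc_of% hp', zero_comp, hg]
  · rw [reassoc_of% hp, hS.exact.g_desc]

variable [HasExt.{w} C] {A B E : C}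

/-- Every class is the class of an extension: killed by an epimorphism onto `A`, it is the image
under the connecting map of some f from the kernel to `B`, hence the class of the pushout along f.
If the pushout sequence splits, the class is zero. -/
theorem ext_one_subsingleton (h : ∀ (E : C) (i : B ⟶ E) (p : E ⟶ A) (w : i ≫ p = 0),
    (ShortComplex.mk i p w).ShortExact → ∃ s : A ⟶ E, s ≫ p = 𝟙 A) :
    Subsingleton (Ext A B 1) := by
  refine subsingleton_of_forall_eq 0 fun x => ?_
  obtain ⟨Z, p, hp, hx⟩ := exists_epi_mk₀_comp_eq_zero (n := 0) x
  have hS : (ShortComplex.mk _ _ (kernel.condition p)).ShortExact :=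
    { exact := ShortComplex.exact_kernel p }
  obtain ⟨y, rfl⟩ := Ext.contravariant_sequence_exact₃ hS B x hx (n₀ := 0) rfl
  obtain ⟨f, rfl⟩ := Ext.mk₀_bijective _ _ |>.2 y
  obtain ⟨E, i, q, w, r, hS', h₁, h₃⟩ := exists_shortExact_pushout hS f
  obtain ⟨s, hs⟩ := h _ i q w hS'
  have hcl : (hS'.extClass : Ext A B 1) = 0 := by
    rw [← Ext.mk₀_id_comp (hS'.extClass : Ext A B 1), ← hs, ← Ext.mk₀_comp_mk₀_assoc]
    exact (congrArg (fun y => (Ext.mk₀ s).comp y (zero_add 1)) hS'.comp_extClass).trans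
      (Ext.comp_zero _ _ _ _ _)
  have := ShortComplex.ShortExact.extClass_naturality hS hS'
    { τ₁ := f, τ₂ := r, τ₃ := 𝟙 A, comm₁₂ := h₁, comm₂₃ := by simp [h₃] }
  rw [hcl, Ext.comp_zero] at this
  exact this

theorem exists_section_of_extClass_eq_zero {S : ShortComplex C} (hS : S.ShortExact)
    (h : (hS.extClass : Ext S.X₃ S.X₁ 1) = 0) : ∃ s : S.X₃ ⟶ S.X₂, s ≫ S.g = 𝟙 _ := by
  obtain ⟨y, hy⟩ := Ext.covariant_sequence_exact₃ S.X₃ hS (Ext.mk₀ (𝟙 _)) (n₁ := 1) rfl (by simp [h])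
  obtain ⟨s, rfl⟩ := Ext.mk₀_bijective _ _ |>.2 y
  exact ⟨s, (Ext.mk₀_bijective _ _).1 (by rw [← hy, Ext.mk₀_comp_mk₀])⟩

theorem ext_subsingleton_of_iso {A' B' : C} {n : ℕ} (e : A ≅ A') (f : B ≅ B')
    [Subsingleton (Ext A' B' n)] : Subsingleton (Ext A B n) := by
  refine subsingleton_of_forall_eq 0 fun x => ?_
  have : (Ext.mk₀ e.hom).comp (((Ext.mk₀ e.inv).comp (x.comp (Ext.mk₀ f.hom) (add_zero n))
    (zero_add n)).comp (Ext.mk₀ f.inv) (add_zero n)) (zero_add n) = x := by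
    simp
  rw [← this, Subsingleton.elim ((Ext.mk₀ e.inv).comp (x.comp (Ext.mk₀ f.hom) (add_zero n))
    (zero_add n)) 0]
  simp

end ExtOne

namespace QuiverRep

variable {k : Type u} [Field k] {V : Type} [Quiver.{0} V] {A B E : QuiverRep k V}

/-- Since Ext(A, E) vanishes, the connecting map from End(A) is onto Ext(A, B). As End(A) consists
of scalars, the class of the sequence spans, and it is nonzero because the sequence does not split.
-/
theorem extGeneratedByIndecomposable_of_shortExact {i : B ⟶ E} {p : E ⟶ A} {w : i ≫ p = 0}
    (hS : (ShortComplex.mk i p w).ShortExact) (hA : IsBrick A) (hE : Indecomposable E)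
    [Subsingleton (Ext.{u + 1} A E 1)] (hs : ¬ ∃ s : A ⟶ E, s ≫ p = 𝟙 A) :
    ExtGeneratedByIndecomposable A B := by
  have hne : (hS.extClass : Ext.{u + 1} A B 1) ≠ 0 := fun h =>
    hs (exists_section_of_extClass_eq_zero hS h)
  have hspan (x : Ext.{u + 1} A B 1) : ∃ c : k, c • (hS.extClass : Ext.{u + 1} A B 1) = x := by
    obtain ⟨y, rfl⟩ := Ext.covariant_sequence_exact₁ A hS x (Subsingleton.elim _ _) (n₀ := 0) rfl
    obtain ⟨f, rfl⟩ := Ext.mk₀_bijective _ _ |>.2 y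
    obtain ⟨c, rfl⟩ := hA.2 f
    exact ⟨c, by simp [Ext.mk₀_smul]⟩
  exact ⟨finrank_eq_one _ hne hspan, E, i, p, w, hS, hE,
    (Submodule.eq_top_iff' (p := Submodule.span k _)).2 fun x =>
      Submodule.mem_span_singleton.2 (hspan x)⟩

end QuiverRep

namespace QuiverRep

/-! ### Extensions of thin representations as systems of difference equations -/

section ThinExt

variable {k : Type u} [Field k] {V : Type} [Quiver.{0} V] {P Q : V → Prop}

/-- Every function on the arrows from `P` to `Q` is the difference of a function on `P ∩ Q`. -/
def IsSolvable (k : Type u) [Field k] (P Q : V → Prop) : Prop :=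
  ∀ c : (s t : V) → (s ⟶ t) → k, ∃ h : V → k, (∀ v, ¬ (P v ∧ Q v) → h v = 0) ∧
    ∀ (s t : V) (α : s ⟶ t), P s → Q t → h t - h s = c s t α

@[simp] theorem pt_zero (v : V) : pt P v (0 : k) = 0 := by
  by_cases h : P v
  · exact coord_injective v (by rw [coord_pt h, map_zero])
  · exact thin_eq_zero h _

theorem act_pt' {s t : V} (α : s ⟶ t) {c : k} (h : ¬ P s → c = 0) :
    act (thin k P) α (pt P s c) = pt P t c := by
  by_cases hs : P s
  · exact act_pt α hs c
  · simp [h hs]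

/-- Lift the generators of `thin k P` vertex by vertex. The failure of the lifts to be natural is a
scalar on each arrow from `P` to `Q`; a solution of the system corrects the lifts by elements of
`thin k Q`. -/
theorem exists_section_of_isSolvable (h : IsSolvable k P Q) {E : QuiverRep k V}
    {i : thin k Q ⟶ E} {p : E ⟶ thin k P} {w : i ≫ p = 0}
    (hS : (ShortComplex.mk i p w).ShortExact) : ∃ s : thin k P ⟶ E, s ≫ p = 𝟙 _ := by
  have hE := shortExact_exact hS
  have hx (v : V) : ∃ x : space E v, lin p v x = pt P v 1 ∧ (¬ P v → x = 0) := by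
    by_cases hv : P v
    · obtain ⟨x, hx⟩ := (hE v).2.2 (pt P v 1)
      exact ⟨x, hx, fun h => absurd hv h⟩
    · exact ⟨0, (thin_eq_zero hv _).trans (thin_eq_zero hv _).symm, fun _ => rfl⟩
  choose x hx hx0 using hx
  have hd (s t : V) (α : s ⟶ t) : ∃ d : space (thin k Q) t,
      P s → lin i t d = act E α (x s) - x t := by
    by_cases hs : P s
    · obtain ⟨d, hd⟩ := ((hE t).2.1 (act E α (x s) - x t)).1 (by
        rw [map_sub, lin_act, hx, hx, act_pt α hs, sub_self])
      exact ⟨d, fun _ => hd⟩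
    · exact ⟨0, fun h => absurd h hs⟩
  choose d hd using hd
  obtain ⟨g, hg0, hg⟩ := h fun s t α => coord Q t (d s t α)
  have hpi (v : V) (y : space (thin k Q) v) : lin p v (lin i v y) = 0 :=
    ((hE v).2.1 _).2 ⟨y, rfl⟩
  refine ⟨fromThin (fun v => x v + lin i v (pt Q v (g v))) (fun v hv => ?_) ?_, ?_⟩
  · rw [hx0 v hv, hg0 v (fun h => hv h.1)]
    simp
  · intro s t α hs
    rw [map_add, ← lin_act, act_pt' α (fun hq => hg0 s fun h => hq h.2),
      ← sub_add_cancel (act E α (x s)) (x t), ← hd s t α hs, add_right_comm, ← map_add, add_comm]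
    congr 2
    by_cases ht : Q t
    · refine coord_injective t ?_
      rw [map_add, coord_pt ht, coord_pt ht, ← hg s t α hs ht, sub_add_cancel]
    · exact (thin_eq_zero ht _).trans (thin_eq_zero ht _).symm
  · refine lin_ext fun v c => ?_
    rw [lin_comp, lin_fromThin, map_smul, map_add, hx, hpi, add_zero, lin_id]
    by_cases hv : P v
    · exact coord_injective v (by simp [coord_pt hv])
    · exact (thin_eq_zero hv _).trans (thin_eq_zero hv _).symm

theorem ext_thin_subsingleton (h : IsSolvable k P Q) :
    Subsingleton (Ext.{u + 1} (thin k P) (thin k Q) 1) :=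
  ext_one_subsingleton fun _ _ _ _ hS => exists_section_of_isSolvable h hS

/-- The vector with a given coordinate, as a linear map. -/
noncomputable def ptLin (P : V → Prop) (v : V) : k →ₗ[k] space (thin k P) v where
  toFun := pt P v
  map_add' a b := by
    by_cases h : P v
    · exact coord_injective v (by simp [coord_pt h])
    · exact (thin_eq_zero h _).trans (thin_eq_zero h _).symm
  map_smul' a b := by
    by_cases h : P v
    · exact coord_injective v (by simp [coord_pt h])
    · exact (thin_eq_zero h _).trans (thin_eq_zero h _).symm

/-- The matrices of an extension of thin representations with given off-diagonal entries. -/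
noncomputable def thinExtensionMap (P Q : V → Prop) (c : (s t : V) → (s ⟶ t) → k) {s t : V}
    (α : s ⟶ t) : space (thin k Q) s × space (thin k P) s →ₗ[k]
      space (thin k Q) t × space (thin k P) t :=
  ((act (thin k Q) α).comp (LinearMap.fst k _ _) +
    c s t α • (ptLin Q t).comp ((coord P s).comp (LinearMap.snd k _ _))).prod
      ((act (thin k P) α).comp (LinearMap.snd k _ _))

/-- The extension of thin representations with given off-diagonal entries. -/
noncomputable def thinExtension (P Q : V → Prop) (c : (s t : V) → (s ⟶ t) → k) :
    QuiverRep k V :=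
  mk (fun v => space (thin k Q) v × space (thin k P) v) (thinExtensionMap P Q c)

theorem act_thinExtension (c : (s t : V) → (s ⟶ t) → k) {s t : V} (α : s ⟶ t)
    (x : space (thin k Q) s × space (thin k P) s) :
    act (thinExtension P Q c) α x =
      (act (thin k Q) α x.1 + c s t α • pt Q t (coord P s x.2), act (thin k P) α x.2) :=
  act_mk (fun v => space (thin k Q) v × space (thin k P) v) (thinExtensionMap P Q c) α x

/-- Use the right-hand sides `c` as off-diagonal entries of an extension. It splits, and the
`Q`-component of a section, evaluated on the generators of `thin k P`, is a solution. -/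
theorem isSolvable_of_subsingleton_ext
    [Subsingleton (Ext.{u + 1} (thin k P) (thin k Q) 1)] : IsSolvable k P Q := by
  intro c
  let i : thin k Q ⟶ thinExtension P Q c := homMk
      (fun v => LinearMap.inl k (space (thin k Q) v) (space (thin k P) v)) fun {s t} α x => by
    refine Eq.trans ?_ (act_thinExtension c α (x, 0)).symm
    refine Prod.ext (Eq.symm ?_) (map_zero _).symm
    have : c s t α • pt Q t (coord P s (0 : space (thin k P) s)) = 0 := by rw [map_zero, pt_zero, smul_zero]
    exact (congrArg (act (thin k Q) α x + ·) this).trans (add_zero _)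
  let p : thinExtension P Q c ⟶ thin k P := homMk
      (fun v => LinearMap.snd k (space (thin k Q) v) (space (thin k P) v))
      fun {s t} α x => congrArg Prod.snd (act_thinExtension c α x)
  have hS : (ShortComplex.mk i p (lin_ext fun v x => rfl)).ShortExact :=
    shortExact_mk i p _ (fun v a b h => congrArg Prod.fst h) (fun v y => ⟨(0, y), rfl⟩)
      fun v y hy => ⟨y.1, Prod.ext rfl (Eq.symm hy)⟩
  obtain ⟨s, hs⟩ := exists_section_of_extClass_eq_zero hS
    (Subsingleton.elim (α := Ext.{u + 1} (thin k P) (thin k Q) 1) _ _)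
  let y (v : V) : space (thin k Q) v × space (thin k P) v := lin s v (pt P v 1)
  have hy (v : V) : (y v).2 = pt P v 1 := congrArg (fun f => lin f v (pt P v 1)) hs
  refine ⟨fun v => coord Q v (y v).1, fun v hv => ?_, fun a b α ha hb => ?_⟩
  · by_cases hQ : Q v
    · have h0 : pt P v (1 : k) = 0 := thin_eq_zero (fun h => hv ⟨h, hQ⟩) _
      have : y v = 0 := by simp only [y, h0, map_zero]; rfl
      simp [this]
    · exact coord_eq_zero hQ _
  · have h1 := congrArg Prod.fst ((congrArg (lin s b) (act_pt α ha 1)).symm.trans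
      ((lin_act s α _).trans (act_thinExtension c α (y a))))
    have h2 : (y b).1 = act (thin k Q) α (y a).1 + c a b α • pt Q b (coord P a (y a).2) := h1
    beta_reduce
    rw [h2, map_add, coord_act α hb, map_smul, coord_pt hb, hy, coord_pt ha, smul_eq_mul]
    ring

end ThinExt

end QuiverRep

/-! ### Solvability of the difference equations on a path -/

section Potential

variable {K : Type*} [Field K]

/-- The chord from `a` to `b` runs strictly below the one from `c` to `d` at the left end, and
strictly above it at the right end, of the common part of their ranges. Here `U t` says that the
`t`-th vertex lies on the upper side. -/
def Traverses (U : ℕ → Prop) (a b c d : ℕ) : Prop :=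
  (a ⊔ c ≤ b ⊓ d) ∧ (a < c ∧ U c ∨ c < a ∧ ¬ U a) ∧ (b < d ∧ U b ∨ d < b ∧ ¬ U d)

/-- Every edge inside the common part a ⊔ c, …, b ⊓ d - 1 carries an equation; the edges leaving it
carry one precisely under the left and right conditions of `Traverses`, with the outer value fixed
to 0. With at most one boundary equation partial sums solve the system; with both there is one
equation too many. -/
theorem exists_potential_iff (K : Type*) [Field K] (U : ℕ → Prop) {a b c d : ℕ} :
    (∀ e : ℕ → K, ∃ h : ℕ → K, (∀ v, ¬ ((a ≤ v ∧ v < b) ∧ (c ≤ v ∧ v < d)) → h v = 0) ∧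
      ∀ j, (U (j + 1) ∧ (a ≤ j ∧ j < b) ∧ (c ≤ j + 1 ∧ j + 1 < d) ∨
        ¬ U (j + 1) ∧ (a ≤ j + 1 ∧ j + 1 < b) ∧ (c ≤ j ∧ j < d)) → h (j + 1) - h j = e j) ↔
    ¬ Traverses U a b c d := by
  constructor
  · rintro H ⟨h1, h2, h3⟩
    -- All equations but the last have right-hand side 0, so the zero value to the left of the
    -- common part propagates through it and contradicts the 1 on the last edge.
    obtain ⟨g, h0, h⟩ := H fun j => if j + 1 = b ⊓ d then 1 else 0
    have key (j : ℕ) (hl : a ⊔ c ≤ j + 1) (hr : j + 1 ≤ b ⊓ d) : g (j + 1) - g j =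
        if j + 1 = b ⊓ d then 1 else 0 := by
      refine h j ?_
      by_cases hU : U (j + 1)
      · have ha : a ≠ j + 1 := by
          rintro rfl
          rcases h2 with h2 | h2
          · omega
          · exact h2.2 hU
        have hd : d ≠ j + 1 := by
          rintro rfl
          rcases h3 with h3 | h3
          · omega
          · exact h3.2 hU
        exact Or.inl ⟨hU, by omega, by omega⟩
      · have hc : c ≠ j + 1 := by
          rintro rfl
          rcases h2 with h2 | h2
          · exact hU h2.2
          · omega
        have hb : b ≠ j + 1 := by
          rintro rfl
          rcases h3 with h3 | h3
          · exact hU h3.2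
          · omega
        exact Or.inr ⟨hU, by omega, by omega⟩
    have hz (m : ℕ) (hm : a ⊔ c - 1 + m < b ⊓ d) : g (a ⊔ c - 1 + m) = 0 := by
      induction m with
      | zero => exact h0 _ (by omega)
      | succ m ih =>
        have := key (a ⊔ c - 1 + m) (by omega) (by omega)
        rw [ih (by omega), if_neg (by omega), sub_zero] at this
        exact this
    have h4 := key (b ⊓ d - 1) (by omega) (by omega)
    rw [if_pos (by omega), h0 _ (by omega)] at h4
    have h5 := hz (b ⊓ d - (a ⊔ c)) (by omega)
    rw [show a ⊔ c - 1 + (b ⊓ d - (a ⊔ c)) = b ⊓ d - 1 by omega] at h5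
    simp [h5] at h4
  · intro H e
    classical
    let C (v : ℕ) : K := ∑ j ∈ Finset.range v, e j
    have hC (j : ℕ) : C (j + 1) = C j + e j := Finset.sum_range_succ _ _
    -- The constant normalizes the partial sums to vanish at whichever outer point carries a
    -- boundary equation.
    let γ : ℕ := if b < d ∧ U b ∨ d < b ∧ ¬ U d then b ⊓ d else a ⊔ c - 1
    refine ⟨fun v => if (a ≤ v ∧ v < b) ∧ (c ≤ v ∧ v < d) then C v - C γ else 0,
      fun v hv => if_neg hv, fun j hj => ?_⟩
    beta_reduce
    by_cases hj0 : (a ≤ j ∧ j < b) ∧ (c ≤ j ∧ j < d)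
    · by_cases hj1 : (a ≤ j + 1 ∧ j + 1 < b) ∧ (c ≤ j + 1 ∧ j + 1 < d)
      · rw [if_pos hj0, if_pos hj1, hC]
        ring
      · rw [if_pos hj0, if_neg hj1]
        have h1 : j + 1 = b ⊓ d := by omega
        have h2 : b < d ∧ U b ∨ d < b ∧ ¬ U d := by
          rcases hj with ⟨hU, h3, h4⟩ | ⟨hU, h3, h4⟩
          · left
            obtain rfl : j + 1 = b := by omega
            exact ⟨by omega, hU⟩
          · right
            obtain rfl : j + 1 = d := by omega
            exact ⟨by omega, hU⟩
        simp only [γ, if_pos h2, ← h1, hC]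
        ring
    · by_cases hj1 : (a ≤ j + 1 ∧ j + 1 < b) ∧ (c ≤ j + 1 ∧ j + 1 < d)
      · rw [if_neg hj0, if_pos hj1]
        have h1 : j + 1 = a ⊔ c := by omega
        have h2 : a < c ∧ U c ∨ c < a ∧ ¬ U a := by
          rcases hj with ⟨hU, h3, h4⟩ | ⟨hU, h3, h4⟩
          · left
            obtain rfl : j + 1 = c := by omega
            exact ⟨by omega, hU⟩
          · right
            obtain rfl : j + 1 = a := by omega
            exact ⟨by omega, hU⟩
        have h3 : ¬ (b < d ∧ U b ∨ d < b ∧ ¬ U d) := fun h3 => H ⟨by omega, h2, h3⟩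
        simp only [γ, if_neg h3, ← h1, hC, Nat.add_sub_cancel]
        ring
      -- An equation with no unknown: the intervals are adjacent at j + 1, and the edge joins the
      -- first to the second.
      · exfalso
        rcases hj with ⟨hU, h3, h4⟩ | ⟨hU, h3, h4⟩
        · obtain rfl : j + 1 = b := by omega
          obtain rfl : j + 1 = c := by omega
          exact H ⟨by omega, Or.inl ⟨by omega, hU⟩, Or.inl ⟨by omega, hU⟩⟩
        · obtain rfl : j + 1 = a := by omega
          obtain rfl : j + 1 = d := by omega
          exact H ⟨by omega, Or.inr ⟨by omega, hU⟩, Or.inr ⟨by omega, hU⟩⟩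

end Potential

/-! ### Intervals in a quiver of type A -/

namespace TypeA

variable {n : ℕ} {ε : Fin (n + 1) → Bool}

/-- The number of a vertex. -/
def idx (v : TypeA n ε) : ℕ := Fin.val (n := n + 2) v

/-- The vertex with a given number. -/
def vertex (ε : Fin (n + 1) → Bool) (j : ℕ) (h : j < n + 2) : TypeA n ε := (⟨j, h⟩ : Fin (n + 2))

theorem idx_lt (v : TypeA n ε) : idx v < n + 2 := Fin.isLt (n := n + 2) v

@[simp] theorem idx_vertex (j : ℕ) (h : j < n + 2) : idx (vertex ε j h) = j := rfl

@[simp] theorem vertex_idx (v : TypeA n ε) : vertex ε (idx v) (idx_lt v) = v := rfl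

instance : Fintype (TypeA n ε) := inferInstanceAs (Fintype (Fin (n + 2)))

/-- The arrow on an edge that points to the right. -/
def arrowRight (i : ℕ) (hi : i < n + 1) (h : ε ⟨i, hi⟩ = true) :
    vertex ε i (by omega) ⟶ vertex ε (i + 1) (by omega) :=
  Arrow.right ⟨i, hi⟩ h

/-- The arrow on an edge that points to the left. -/
def arrowLeft (i : ℕ) (hi : i < n + 1) (h : ε ⟨i, hi⟩ = false) :
    vertex ε (i + 1) (by omega) ⟶ vertex ε i (by omega) :=
  Arrow.left ⟨i, hi⟩ h

theorem arrow_induction {motive : ∀ {s t : TypeA n ε}, (s ⟶ t) → Prop}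
    (right : ∀ i hi h, motive (arrowRight (ε := ε) i hi h))
    (left : ∀ i hi h, motive (arrowLeft (ε := ε) i hi h)) {s t : TypeA n ε} (α : s ⟶ t) :
    motive α :=
  match s, t, α with
  | _, _, Arrow.right i h => right i.1 i.2 h
  | _, _, Arrow.left i h => left i.1 i.2 h

/-- The points above which the polygon has an upper vertex: those on arrows to the right. -/
def IsUpper (ε : Fin (n + 1) → Bool) (t : ℕ) : Prop :=
  ∃ i : Fin (n + 1), i.val + 1 = t ∧ ε i = true

theorem isUpper_succ {i : ℕ} (hi : i < n + 1) : IsUpper ε (i + 1) ↔ ε ⟨i, hi⟩ = true := by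
  constructor
  · rintro ⟨⟨j, hj⟩, h1, h2⟩
    obtain rfl : j = i := by simpa using h1
    exact h2
  · exact fun h => ⟨_, rfl, h⟩

/-- The vertices from `a` to `b - 1`. -/
def interval (ε : Fin (n + 1) → Bool) (a b : ℕ) (v : TypeA n ε) : Prop := a ≤ idx v ∧ idx v < b

theorem connectedSupport_interval (k : Type u) [Field k] {a b : ℕ} (h : a < b) (hb : b ≤ n + 2) :
    QuiverRep.ConnectedSupport k (interval ε a b) := by
  refine ⟨⟨vertex ε a (by omega), le_rfl, h⟩, fun c hc => ?_⟩
  have key (j : ℕ) (ha : a ≤ j) (hj : j < b) :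
      c (vertex ε j (by omega)) = c (vertex ε a (by omega)) := by
    induction j, ha using Nat.le_induction with
    | base => rfl
    | succ j ha ih =>
      rw [← ih (by omega)]
      by_cases hε : ε ⟨j, by omega⟩ = true
      · exact (hc (arrowRight j (by omega) hε) ⟨ha, by simp; omega⟩
          ⟨by simp; omega, hj⟩).symm
      · exact hc (arrowLeft j (by omega) (by simpa using hε)) ⟨by simp; omega, hj⟩
          ⟨ha, by simp; omega⟩
  intro v w hv hw
  exact (key _ hv.1 hv.2).trans (key _ hw.1 hw.2).symm

theorem isSolvable_interval_iff (k : Type u) [Field k] {a b c d : ℕ} (hb : b ≤ n + 2)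
    (hd : d ≤ n + 2) : QuiverRep.IsSolvable k (interval ε a b) (interval ε c d) ↔
      ¬ Traverses (IsUpper ε) a b c d := by
  rw [← exists_potential_iff k]
  constructor
  · intro H e
    -- An arrow to the left runs against the numbering of the path, hence the sign.
    obtain ⟨f, h0, h⟩ := H fun s t _ =>
      if idx s < idx t then e (idx s) else - e (idx t)
    refine ⟨fun v => if hv : v < n + 2 then f (vertex ε v hv) else 0, fun v hv => ?_,
      fun j hj => ?_⟩
    · by_cases hv' : v < n + 2
      · exact (dif_pos hv').trans (h0 _ hv)
      · exact dif_neg hv'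
    · have hj' : j < n + 1 := by omega
      beta_reduce
      rw [dif_pos (by omega), dif_pos (by omega)]
      rw [isUpper_succ hj'] at hj
      rcases hj with ⟨hε, h1, h2⟩ | ⟨hε, h1, h2⟩
      · have := h _ _ (arrowRight j hj' hε) h1 h2
        simpa using this
      · have := h _ _ (arrowLeft j hj' (by simpa using hε)) h1 h2
        rw [← neg_sub, this]
        simp
  · intro H g
    obtain ⟨f, h0, h⟩ := H fun j => if hj : j < n + 1 then
      if hε : ε ⟨j, hj⟩ = true then g _ _ (arrowRight j hj hε)
      else - g _ _ (arrowLeft j hj (by simpa using hε)) else 0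
    refine ⟨fun v => f (idx v), fun v hv => h0 _ hv, fun s t α => ?_⟩
    induction α using arrow_induction with
    | right i hi hε =>
      intro h1 h2
      have := h i (Or.inl ⟨(isUpper_succ hi).2 hε, h1, h2⟩)
      rw [dif_pos hi, dif_pos hε] at this
      exact this
    | left i hi hε =>
      intro h1 h2
      have := h i (Or.inr ⟨by rw [isUpper_succ hi]; simp [hε], h1, h2⟩)
      rw [dif_pos hi, dif_neg (by simp [hε])] at this
      rw [← neg_sub]
      exact neg_eq_iff_eq_neg.2 this

end TypeA

namespace QuiverRep

/-! ### Ext between interval representations and crossing chords -/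

section ThinHom

variable {k : Type u} [Field k] {V : Type} [Quiver.{0} V] {P Q : V → Prop}

open scoped Classical in
/-- The morphism of thin representations that is the identity on the intersection. -/
noncomputable def thinHom (h : ∀ {s t : V}, (s ⟶ t) → P s → Q t → (P t ↔ Q s)) :
    thin k P ⟶ thin k Q :=
  toThin (fun v => if Q v then coord P v else 0) (fun _ hv => if_neg hv) fun {s t} α ht x => by
    rw [if_pos ht]
    by_cases hs : P s
    · by_cases hQ : Q s
      · rw [if_pos hQ, coord_act α ((h α hs ht).2 hQ)]
      · rw [if_neg hQ, coord_eq_zero (fun hp => hQ ((h α hs ht).1 hp)), LinearMap.zero_apply]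
    · rw [thin_eq_zero hs x]
      simp

theorem coord_thinHom (h : ∀ {s t : V}, (s ⟶ t) → P s → Q t → (P t ↔ Q s)) {v : V} (hv : Q v)
    (x : space (thin k P) v) : coord Q v (lin (thinHom h) v x) = coord P v x := by
  classical
  exact congrArg (fun f : space (thin k P) v →ₗ[k] k => f x) (if_pos hv)

/-- As no arrow leads from `Q` to `P`, the part on `Q` is a subrepresentation of the thin
representation on the union, with quotient the part on `P`. -/
theorem exists_shortExact_thin (hPQ : ∀ v, P v → ¬ Q v)
    (h : ∀ {s t : V}, (s ⟶ t) → Q s → ¬ P t) :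
    ∃ (i : thin k Q ⟶ thin k fun v => P v ∨ Q v) (p : (thin k fun v => P v ∨ Q v) ⟶ thin k P)
      (w : i ≫ p = 0), (ShortComplex.mk i p w).ShortExact := by
  have hi : ∀ {s t : V}, (s ⟶ t) → Q s → (P t ∨ Q t) → (Q t ↔ P s ∨ Q s) :=
    fun α hs ht => ⟨fun _ => Or.inr hs, fun _ => ht.resolve_left (h α hs)⟩
  have hp : ∀ {s t : V}, (s ⟶ t) → (P s ∨ Q s) → P t → ((P t ∨ Q t) ↔ P s) :=
    fun α hs ht => ⟨fun _ => hs.resolve_right fun hs => h α hs ht, fun _ => Or.inl ht⟩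
  refine ⟨thinHom hi, thinHom (P := fun v => P v ∨ Q v) hp, ?_, ?_⟩
  · refine lin_ext fun v x => ?_
    by_cases hv : P v
    · rw [thin_eq_zero (hPQ v hv) x, map_zero, map_zero]
    · exact (thin_eq_zero hv _).trans (thin_eq_zero hv _).symm
  · refine shortExact_mk _ _ _ (fun v => ?_) (fun v y => ?_) fun v y hy => ?_
    · refine (injective_iff_map_eq_zero _).2 fun x hx => ?_
      by_cases hv : Q v
      · refine coord_injective v ?_
        rw [← coord_thinHom hi (Or.inr hv), hx, map_zero, map_zero]
      · exact thin_eq_zero hv x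
    · by_cases hv : P v
      · refine ⟨pt _ v (coord P v y), coord_injective v ?_⟩
        rw [coord_thinHom (P := fun v => P v ∨ Q v) hp hv,
          coord_pt (P := fun v => P v ∨ Q v) (Or.inl hv)]
      · exact ⟨0, (thin_eq_zero hv _).trans (thin_eq_zero hv _).symm⟩
    · by_cases hv : P v
      · refine ⟨0, coord_injective v ?_⟩
        conv_rhs => rw [← coord_thinHom (P := fun v => P v ∨ Q v) hp hv, hy]
        rw [map_zero, map_zero, map_zero]
      · by_cases hQ : Q v
        · refine ⟨pt _ v (coord _ v y), coord_injective v ?_⟩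
          rw [coord_thinHom hi (Or.inr hQ), coord_pt hQ]
        · exact ⟨0, (thin_eq_zero (not_or.2 ⟨hv, hQ⟩) _).trans
            (thin_eq_zero (not_or.2 ⟨hv, hQ⟩) _).symm⟩

end ThinHom

end QuiverRep

/-- The chords between the points `0, …, n + 2`. -/
abbrev Chord (n : ℕ) : Type := {p : ℕ × ℕ // p.1 < p.2 ∧ p.2 ≤ n + 2}

/-- The chords cross: one of them runs below the other on one side and above it on the other. -/
def Crosses {n : ℕ} (U : ℕ → Prop) (p q : Chord n) : Prop :=
  p.1.1 ⊔ q.1.1 < p.1.2 ⊓ q.1.2 ∧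
    (Traverses U p.1.1 p.1.2 q.1.1 q.1.2 ∨ Traverses U q.1.1 q.1.2 p.1.1 p.1.2)

namespace QuiverRep

theorem IsBrick.of_iso {k : Type u} [Field k] {V : Type} [Quiver.{0} V] {X Y : QuiverRep k V}
    (h : IsBrick X) (e : X ≅ Y) : IsBrick Y := by
  refine ⟨fun hY => h.1 (hY.of_iso e), fun f => ?_⟩
  obtain ⟨c, hc⟩ := h.2 (e.hom ≫ f ≫ e.inv)
  refine ⟨c, ?_⟩
  have : f = e.inv ≫ (e.hom ≫ f ≫ e.inv) ≫ e.hom := by simp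
  rw [this, hc]
  simp

theorem isExtAdmissible_of_iso {k : Type u} [Field k] {V : Type} [Quiver.{0} V]
    {P Q : V → Prop} {A B : QuiverRep k V} (e : A ≅ thin k P) (f : B ≅ thin k Q)
    (hP : ConnectedSupport k P) (hPQ' : ConnectedSupport k fun v => P v ∨ Q v)
    (hQ : ∃ v, Q v) (hPQ : ∀ v, P v → ¬ Q v) (h : ∀ {s t : V}, (s ⟶ t) → Q s → ¬ P t)
    (hs : IsSolvable k P fun v => P v ∨ Q v) : IsExtAdmissible A B := by
  right
  obtain ⟨i, p, w, hS⟩ := exists_shortExact_thin (k := k) hPQ h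
  have w' : (f.hom ≫ i) ≫ p ≫ e.inv = 0 := by simp [reassoc_of% w]
  have hS' : (ShortComplex.mk (f.hom ≫ i) (p ≫ e.inv) w').ShortExact :=
    ShortComplex.shortExact_of_iso (S₁ := ShortComplex.mk i p w)
      (ShortComplex.isoMk f.symm (Iso.refl _) e.symm) hS
  have := ext_thin_subsingleton hs
  have := ext_subsingleton_of_iso (n := 1) e (Iso.refl (thin k fun v => P v ∨ Q v))
  refine extGeneratedByIndecomposable_of_shortExact hS' ((isBrick_thin hP).of_iso e.symm)
    (isBrick_thin hPQ').indecomposable ?_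
  rintro ⟨s, hs⟩
  obtain ⟨v, hv⟩ := hQ
  refine (isBrick_thin hP).1 ((IsZero.iff_id_eq_zero _).2 ?_)
  -- A section would factor the identity of `thin k P` through a thin representation with a
  -- different support.
  rw [← thin_comp_eq_zero hP hPQ' (v := v) (fun h => hPQ v (h.2 (Or.inr hv)) hv) (e.inv ≫ s) p]
  rw [← cancel_mono e.inv, Category.assoc, Category.assoc, hs]
  simp

open TypeA

variable {k : Type u} [Field k] {n : ℕ} {ε : Fin (n + 1) → Bool}

variable (k ε) in
/-- The indecomposable representation attached to a chord. -/
noncomputable def chordRep (p : Chord n) : QuiverRep k (TypeA n ε) :=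
  thin k (interval ε p.1.1 p.1.2)

theorem exists_mem_interval {a b : ℕ} (h : a < b) (hb : b ≤ n + 2) : ∃ v, interval ε a b v :=
  ⟨vertex ε a (by omega), le_rfl, h⟩

/-- A nonzero Ext without crossing forces adjacent supports. The middle term is then the interval on
the union, which shares an end with `p`; so `Traverses` fails for that pair and Ext(A, E) vanishes.
-/
theorem isExtAdmissible_chordRep {p q : Chord n} (h : ¬ Crosses (IsUpper ε) p q)
    {A B : QuiverRep k (TypeA n ε)} (e : A ≅ chordRep k ε p) (f : B ≅ chordRep k ε q) :
    IsExtAdmissible A B := by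
  obtain ⟨⟨a, b⟩, hab, hb⟩ := p
  obtain ⟨⟨c, d⟩, hcd, hd⟩ := q
  dsimp only [Crosses] at *
  by_cases hT : Traverses (IsUpper ε) a b c d
  · have hc : b = c ∨ d = a := by
      have := hT.1
      have : ¬ (a ⊔ c < b ⊓ d) := fun h1 => h ⟨h1, Or.inl hT⟩
      omega
    rcases hc with rfl | rfl
    · have hU : IsUpper ε b := by
        rcases hT.2.1 with h | h
        · exact h.2
        · omega
      have hE : (fun v => interval ε a b v ∨ interval ε b d v) = interval ε a d := by
        ext v
        simp only [interval]
        omega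
      refine isExtAdmissible_of_iso e f (connectedSupport_interval k hab hb)
        (hE ▸ connectedSupport_interval k (by omega) hd) (exists_mem_interval hcd hd)
        (fun v hv hv' => by simp only [interval] at hv hv'; omega) (fun {s t} α => ?_) ?_
      · induction α using arrow_induction with
        | right i hi hα =>
          simp only [interval, idx_vertex]
          omega
        | left i hi hα =>
          simp only [interval, idx_vertex]
          intro h1 h2
          obtain rfl : i + 1 = b := by omega
          simp [isUpper_succ hi, hα] at hU
      · rw [hE, isSolvable_interval_iff k hb hd]
        rintro ⟨-, h1 | h1, -⟩ <;> exact lt_irrefl _ h1.1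
    · have hU : ¬ IsUpper ε d := by
        rcases hT.2.1 with h | h
        · omega
        · exact h.2
      have hE : (fun v => interval ε d b v ∨ interval ε c d v) = interval ε c b := by
        ext v
        simp only [interval]
        omega
      refine isExtAdmissible_of_iso e f (connectedSupport_interval k hab hb)
        (hE ▸ connectedSupport_interval k (by omega) hb) (exists_mem_interval hcd hd)
        (fun v hv hv' => by simp only [interval] at hv hv'; omega) (fun {s t} α => ?_) ?_
      · induction α using arrow_induction with
        | right i hi hα =>
          simp only [interval, idx_vertex]
          intro h1 h2
          obtain rfl : i + 1 = d := by omega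
          simp [isUpper_succ hi, hα] at hU
        | left i hi hα =>
          simp only [interval, idx_vertex]
          omega
      · rw [hE, isSolvable_interval_iff k hb hb]
        rintro ⟨-, -, h1 | h1⟩ <;> exact lt_irrefl _ h1.1
  · left
    have : Subsingleton (Ext.{u + 1} (chordRep k ε ⟨(a, b), hab, hb⟩)
        (chordRep k ε ⟨(c, d), hcd, hd⟩) 1) :=
      ext_thin_subsingleton ((isSolvable_interval_iff (ε := ε) k hb hd).2 hT)
    exact ext_subsingleton_of_iso (n := 1) e f

/-- Ext is nonzero, and any middle term has dimension two at a common vertex, whereas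
indecomposables have dimension at most one everywhere. -/
theorem not_isExtAdmissible_chordRep (hM : IsBrickSystem (chordRep k ε)) {p q : Chord n}
    (h : p.1.1 ⊔ q.1.1 < p.1.2 ⊓ q.1.2)
    (hT : Traverses (IsUpper ε) p.1.1 p.1.2 q.1.1 q.1.2) :
    ¬ IsExtAdmissible (chordRep k ε p) (chordRep k ε q) := by
  rintro ((hs : Subsingleton (Ext.{u + 1} (thin k _) (thin k _) 1)) | ⟨-, E, i, p', w, hS, hE, -⟩)
  · exact (isSolvable_interval_iff k p.2.2 q.2.2).1
      isSolvable_of_subsingleton_ext hT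
  · obtain ⟨r, ⟨e⟩⟩ := hM.exists_iso hE
    have hp := p.2
    have := finrank_of_shortExact hS (vertex ε (p.1.1 ⊔ q.1.1) (by omega))
    rw [LinearEquiv.finrank_eq (spaceEquiv e _), chordRep, chordRep, chordRep,
      finrank_thin (P := interval ε p.1.1 p.1.2) (by simp only [interval, idx_vertex]; omega),
      finrank_thin (P := interval ε q.1.1 q.1.2) (by simp only [interval, idx_vertex]; omega)]
      at this
    have h1 := finrank_thin_le (k := k) (P := interval ε r.1.1 r.1.2)
      (vertex ε (p.1.1 ⊔ q.1.1) (by omega))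
    omega

theorem isCompatibility_chordRep (hM : IsBrickSystem (chordRep k ε)) :
    IsCompatibility (chordRep k ε) fun p q => ¬ Crosses (IsUpper ε) p q where
  refl p := by
    rintro ⟨-, ⟨-, h, -⟩ | ⟨-, h, -⟩⟩ <;> omega
  symm {p q} h h' := h ⟨by rw [sup_comm, inf_comm]; exact h'.1, h'.2.symm⟩
  isExtAdmissible h _ _ e f := isExtAdmissible_chordRep h e f
  of_isExtAdmissible {p q} h1 h2 := by
    rintro ⟨h, hT | hT⟩
    · exact not_isExtAdmissible_chordRep hM h hT h1
    · exact not_isExtAdmissible_chordRep hM (by rw [sup_comm, inf_comm]; exact h) hT h2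

end QuiverRep

/-! ### Chains of vectors and of linear forms; splitting off an interval -/

namespace QuiverRep

open TypeA

variable {k : Type u} [Field k] {n : ℕ} {ε : Fin (n + 1) → Bool} (X : QuiverRep k (TypeA n ε))

/-- The vectors at the ends of an edge correspond under the map of the edge. -/
def EdgeRel (i : ℕ) (hi : i < n + 1) (x : space X (vertex ε i (by omega)))
    (y : space X (vertex ε (i + 1) (by omega))) : Prop :=
  (∀ h : ε ⟨i, hi⟩ = true, act X (arrowRight i hi h) x = y) ∧
    ∀ h : ε ⟨i, hi⟩ = false, act X (arrowLeft i hi h) y = x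

/-- The linear forms at the ends of an edge correspond under the map of the edge. -/
def DualEdgeRel (i : ℕ) (hi : i < n + 1) (φ : space X (vertex ε i (by omega)) →ₗ[k] k)
    (ψ : space X (vertex ε (i + 1) (by omega)) →ₗ[k] k) : Prop :=
  (∀ h : ε ⟨i, hi⟩ = true, ∀ x, ψ (act X (arrowRight i hi h) x) = φ x) ∧
    ∀ h : ε ⟨i, hi⟩ = false, ∀ y, φ (act X (arrowLeft i hi h) y) = ψ y

variable {X} in
theorem DualEdgeRel.apply_eq {i : ℕ} {hi : i < n + 1} {φ : space X (vertex ε i (by omega)) →ₗ[k] k}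
    {ψ : space X (vertex ε (i + 1) (by omega)) →ₗ[k] k} (h : DualEdgeRel X i hi φ ψ)
    {x : space X (vertex ε i (by omega))} {y : space X (vertex ε (i + 1) (by omega))}
    (h' : EdgeRel X i hi x y) : φ x = ψ y := by
  by_cases hε : ε ⟨i, hi⟩ = true
  · rw [← h.1 hε, h'.1 hε]
  · have hε : ε ⟨i, hi⟩ = false := by simpa using hε
    rw [← h.2 hε, h'.2 hε]

/-- The families of vectors that correspond under all maps between the vertices `a` and `b`. -/
def chains (a b : ℕ) : Submodule k (∀ v, space X v) where
  carrier := {x | ∀ i (hi : i < n + 1), a ≤ i → i < b → EdgeRel X i hi (x _) (x _)}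
  add_mem' hx hy i hi ha hb :=
    ⟨fun h => by simp [(hx i hi ha hb).1 h, (hy i hi ha hb).1 h],
      fun h => by simp [(hx i hi ha hb).2 h, (hy i hi ha hb).2 h]⟩
  zero_mem' i hi ha hb := ⟨fun h => map_zero _, fun h => map_zero _⟩
  smul_mem' c x hx i hi ha hb :=
    ⟨fun h => by simp [(hx i hi ha hb).1 h], fun h => by simp [(hx i hi ha hb).2 h]⟩

variable {X} {a b : ℕ}

theorem chains_anti {c : ℕ} (h : b ≤ c) {x : ∀ v, space X v} (hx : x ∈ chains X a c) :
    x ∈ chains X a b :=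
  fun i hi ha hb => hx i hi ha (hb.trans_le h)

theorem vertex_injective {i j : ℕ} {hi : i < n + 2} {hj : j < n + 2}
    (h : vertex ε i hi = vertex ε j hj) : i = j := congrArg idx h

open scoped Classical in
theorem update_mem_chains {x : ∀ v, space X v} (hx : x ∈ chains X a b) (hb : b < n + 1)
    {y : space X (vertex ε (b + 1) (by omega))} (hy : EdgeRel X b hb (x _) y) :
    Function.update x (vertex ε (b + 1) (by omega)) y ∈ chains X a (b + 1) := by
  intro i hi ha hib
  rw [Function.update_of_ne (fun h => by have := vertex_injective h; omega)]
  by_cases h : i = b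
  · subst h
    rwa [Function.update_self]
  · rw [Function.update_of_ne (fun h => by have := vertex_injective h; omega)]
    exact hx i hi ha (by omega)

theorem exists_linearMap_comp_eq {E W : Type*} [AddCommGroup E] [Module k E] [AddCommGroup W]
    [Module k W] (p : E →ₗ[k] W) (l : E →ₗ[k] k) (h : ∀ x, p x = 0 → l x = 0) :
    ∃ φ : W →ₗ[k] k, ∀ x, φ (p x) = l x := by
  have : l ∈ LinearMap.range p.dualMap := by
    rw [LinearMap.range_dualMap_eq_dualAnnihilator_ker, Submodule.mem_dualAnnihilator]
    exact fun x hx => h x hx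
  obtain ⟨φ, hφ⟩ := this
  exact ⟨φ, fun x => congrArg (fun f => f x) hφ⟩

open scoped Classical in
/-- Linear forms at `a` and `b` that agree on all chains belong to a chain of linear forms. -/
theorem exists_dual_chain (hab : a ≤ b) (hb : b < n + 2)
    (φa : space X (vertex ε a (by omega)) →ₗ[k] k) (φb : space X (vertex ε b hb) →ₗ[k] k)
    (h : ∀ x ∈ chains X a b, φa (x _) = φb (x _)) :
    ∃ φ : ∀ v, space X v →ₗ[k] k, φ _ = φa ∧ φ _ = φb ∧
      ∀ i (hi : i < n + 1), a ≤ i → i < b → DualEdgeRel X i hi (φ _) (φ _) := by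
  induction b, hab using Nat.le_induction with
  | base =>
    have : φa = φb := by
      ext y
      simpa using h (Function.update 0 (vertex ε a (by omega)) y) (fun i _ _ _ => by omega)
    subst this
    exact ⟨Function.update 0 (vertex ε a (by omega)) φa, by simp, by simp, fun i _ _ _ => by omega⟩
  | succ b hab ih =>
    have hb' : b < n + 1 := by omega
    -- Move the form one edge back. Along an arrow to the right it is pulled back. Along an arrow to
    -- the left it is prescribed both on the ends of chains and on the image of the arrow; the
    -- hypothesis, applied to a chain extended by -z, says that the prescriptions agree.
    obtain ⟨ψ, hψ, hψ'⟩ : ∃ ψ : space X (vertex ε b (by omega)) →ₗ[k] k,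
        (∀ x ∈ chains X a b, φa (x _) = ψ (x _)) ∧ DualEdgeRel X b hb' ψ φb := by
      by_cases hε : ε ⟨b, hb'⟩ = true
      · refine ⟨φb.comp (act X (arrowRight b hb' hε)), fun x hx => ?_, fun _ _ => rfl,
          fun hε' => by simp [hε] at hε'⟩
        have := h _ (update_mem_chains hx hb' (y := act X (arrowRight b hb' hε) (x _))
          ⟨fun _ => rfl, fun hε' => by simp [hε] at hε'⟩)
        rw [Function.update_self,
          Function.update_of_ne (fun h => by have := vertex_injective h; omega)] at this
        exact this
      · have hε : ε ⟨b, hb'⟩ = false := by simpa using hε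
        let e (v : TypeA n ε) : chains X a b →ₗ[k] space X v :=
          (LinearMap.proj v).comp (chains X a b).subtype
        obtain ⟨ψ, hψ⟩ := exists_linearMap_comp_eq
          ((e (vertex ε b (by omega))).coprod (act X (arrowLeft b hb' hε)))
          ((φa.comp (e _)).coprod φb) (by
            rintro ⟨x, z⟩ hx
            have h1 : x.1 (vertex ε b _) + act X (arrowLeft b hb' hε) z = 0 := hx
            have := h _ (update_mem_chains x.2 hb' (y := - z)
              ⟨fun hε' => by simp [hε] at hε', fun _ => by
                rw [map_neg]; exact (eq_neg_of_add_eq_zero_left h1).symm⟩)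
            rw [Function.update_self,
              Function.update_of_ne (fun h => by have := vertex_injective h; omega)] at this
            change φa (x.1 _) + φb z = 0
            rw [this, map_neg]
            exact neg_add_cancel _)
        refine ⟨ψ, fun x hx => ?_, fun hε' => by simp [hε] at hε', fun _ y => ?_⟩
        · simpa [e] using (hψ (⟨x, hx⟩, 0)).symm
        · simpa [e] using hψ (0, y)
    obtain ⟨φ, h1, h2, h3⟩ := ih (by omega) φa ψ hψ
    refine ⟨Function.update φ (vertex ε (b + 1) hb) φb, ?_, Function.update_self _ _ _,
      fun i hi ha hib => ?_⟩
    · rwa [Function.update_of_ne (fun h => by have := vertex_injective h; omega)]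
    · rw [Function.update_of_ne (fun h => by have := vertex_injective h; omega)]
      by_cases hi' : i = b
      · subst hi'
        rwa [Function.update_self, h2]
      · rw [Function.update_of_ne (fun h => by have := vertex_injective h; omega)]
        exact h3 i hi ha (by omega)

end QuiverRep

namespace QuiverRep

open TypeA

variable {k : Type u} [Field k] {n : ℕ} {ε : Fin (n + 1) → Bool} {X : QuiverRep k (TypeA n ε)}

variable (X) in
/-- All vectors at `a` extend to chains up to `b`, and nonzero ones to chains that are nonzero
at `b`. -/
def Persists (a b : ℕ) (ha : a < n + 2) (hb : b < n + 2) : Prop :=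
  (∀ y : space X (vertex ε a ha), ∃ x ∈ chains X a b, x _ = y) ∧
    ∀ x ∈ chains X a b, x (vertex ε b hb) = 0 → x (vertex ε a ha) = 0

open scoped Classical in
theorem persists_self (a : ℕ) (ha : a < n + 2) : Persists X a a ha ha :=
  ⟨fun y => ⟨Function.update 0 _ y, fun i _ _ _ => by omega, Function.update_self _ _ _⟩,
    fun _ _ h => h⟩

/-- A chain and a dual chain between `a` and `b`, pairing to `1`, that define an interval
summand. -/
structure IntervalData (X : QuiverRep k (TypeA n ε)) (a b : ℕ) (ha : a < n + 2) (hb : b < n + 2)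
    (x : ∀ v, space X v) (φ : ∀ v, space X v →ₗ[k] k) : Prop where
  le : a ≤ b
  chain : x ∈ chains X a b
  dualChain : ∀ i (hi : i < n + 1), a ≤ i → i < b → DualEdgeRel X i hi (φ _) (φ _)
  pairing : φ (vertex ε a ha) (x _) = 1
  right : ∀ (hb : b < n + 1) (hε : ε ⟨b, hb⟩ = true), act X (arrowRight b hb hε) (x _) = 0
  left : ∀ (hb : b < n + 1) (hε : ε ⟨b, hb⟩ = false) z, φ _ (act X (arrowLeft b hb hε) z) = 0

theorem IntervalData.pairing_eq_one {a b : ℕ} {ha : a < n + 2} {hb : b < n + 2}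
    {x : ∀ v, space X v} {φ : ∀ v, space X v →ₗ[k] k} (h : IntervalData X a b ha hb x φ) (j : ℕ)
    (haj : a ≤ j) (hj : j ≤ b) : φ (vertex ε j (by omega)) (x _) = 1 := by
  induction j, haj using Nat.le_induction with
  | base => exact h.pairing
  | succ j haj ih =>
    rw [← ih (by omega)]
    exact ((h.dualChain j (by omega) haj (by omega)).apply_eq
      (h.chain j (by omega) haj (by omega))).symm

/-- A dual chain up to `b` whose values on chains are prescribed at `a`. -/
theorem exists_dual_chain_of_persists {a b : ℕ} (hab : a ≤ b) (ha : a < n + 2) (hb : b < n + 2)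
    (h : Persists X a b ha hb) (φa : space X (vertex ε a ha) →ₗ[k] k) :
    ∃ φ : ∀ v, space X v →ₗ[k] k, φ _ = φa ∧
      ∀ i (hi : i < n + 1), a ≤ i → i < b → DualEdgeRel X i hi (φ _) (φ _) := by
  let e (v : TypeA n ε) : chains X a b →ₗ[k] space X v :=
    (LinearMap.proj v).comp (chains X a b).subtype
  obtain ⟨φb, hφb⟩ := exists_linearMap_comp_eq (e (vertex ε b hb)) (φa.comp (e _))
    fun x hx => (congrArg φa (h.2 x.1 x.2 hx)).trans (map_zero φa)
  obtain ⟨φ, h1, -, h2⟩ := exists_dual_chain hab hb φa φb fun x hx => (hφb ⟨x, hx⟩).symm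
  exact ⟨φ, h1, h2⟩

/-- Go right until `Persists` first fails, between b and b + 1. If some vector at a no longer
extends, take a chain x from it and a form vanishing on the extendable vectors. If instead a chain
nonzero at a dies at b + 1, take that chain and any form equal to 1 on it. If it never fails, the
interval reaches the last vertex. -/
theorem exists_intervalData (a : ℕ) (ha : a < n + 2) [Nontrivial (space X (vertex ε a ha))] :
    ∃ b hb x φ, IntervalData X a b ha hb x φ := by
  classical
  by_cases h : ∃ b, a ≤ b ∧ ∃ hb : b < n + 1,
      Persists X a b ha (by omega) ∧ ¬ Persists X a (b + 1) ha (by omega)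
  · obtain ⟨b, hab, hb, h12, h3⟩ := h
    have ⟨h1, h2⟩ := h12
    by_cases h4 : ∀ x ∈ chains X a (b + 1), x (vertex ε (b + 1) (by omega)) = 0 →
        x (vertex ε a ha) = 0
    · have h5 : ∃ y : space X (vertex ε a ha), ∀ x ∈ chains X a (b + 1), x _ ≠ y := by
        by_contra! h5
        exact h3 ⟨h5, h4⟩
      obtain ⟨y, hy⟩ := h5
      obtain ⟨φa, hφy, hφa⟩ := LinearMap.exists_extend_of_notMem
        (p := (chains X a (b + 1)).map (LinearMap.proj (R := k) (vertex ε a ha))) (0 : _ →ₗ[k] k)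
        (v := y) (by rintro ⟨x, hx, hxy⟩; exact hy x hx hxy) 1
      obtain ⟨φ, rfl, h6, h7⟩ := exists_dual_chain (X := X) (b := b + 1) (by omega) (by omega) φa 0
        fun x hx => congrArg (fun f => f ⟨_, x, hx, rfl⟩) hφy
      obtain ⟨x, hx, rfl⟩ := h1 y
      -- An arrow to the right would extend the chain of `y`, so the edge points left.
      have hε (hε : ε ⟨b, hb⟩ = true) : False :=
        hy _ (update_mem_chains hx hb (y := act X (arrowRight b hb hε) (x _))
          ⟨fun _ => rfl, fun hε' => by simp [hε] at hε'⟩)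
          (Function.update_of_ne (fun h => by have := vertex_injective h; omega) _ _)
      refine ⟨b, by omega, x, φ, hab, hx, fun i hi hai hib => h7 i hi hai (by omega), hφa,
        fun _ h => (hε h).elim, fun _ h z => ?_⟩
      rw [(h7 b hb hab (by omega)).2 h z, h6]
      rfl
    · push Not at h4
      obtain ⟨x, hx, hxb, hxa⟩ := h4
      obtain ⟨φa, -, hφa⟩ := LinearMap.exists_extend_of_notMem
        (p := ⊥) (0 : _ →ₗ[k] k) (v := x (vertex ε a ha)) (by simpa using hxa) 1
      obtain ⟨φ, rfl, h6⟩ := exists_dual_chain_of_persists hab ha (by omega) h12 φa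
      refine ⟨b, by omega, x, φ, hab, chains_anti (Nat.le_succ b) hx, h6, hφa,
        fun _ h => ?_, fun _ h z => ?_⟩
      · rw [(hx b hb hab (by omega)).1 h, hxb]
      -- An arrow to the left would send 0 to the value at b, so the chain would already die at b,
      -- against persistence.
      · refine absurd (h2 x (chains_anti (Nat.le_succ b) hx) ?_) hxa
        rw [← (hx b hb hab (by omega)).2 h, hxb, map_zero]
  · push Not at h
    have h1 (b : ℕ) (hab : a ≤ b) (hb : b < n + 2) : Persists X a b ha hb := by
      induction b, hab using Nat.le_induction with
      | base => exact persists_self a ha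
      | succ b hab ih => exact h b hab (by omega) (ih (by omega))
    obtain ⟨y, hy⟩ := exists_ne (0 : space X (vertex ε a ha))
    obtain ⟨φa, -, hφa⟩ := LinearMap.exists_extend_of_notMem
      (p := ⊥) (0 : _ →ₗ[k] k) (v := y) (by simpa using hy) 1
    have h2 := h1 (n + 1) (by omega) (by omega)
    obtain ⟨φ, rfl, h6⟩ := exists_dual_chain_of_persists (by omega) ha (by omega) h2 φa
    obtain ⟨x, hx, rfl⟩ := h2.1 y
    exact ⟨n + 1, by omega, x, φ, by omega, hx, h6, hφa, fun h => by omega, fun h => by omega⟩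

/-- The chain is a morphism from the interval representation and the dual chain a morphism to it.
The boundary conditions give naturality at the right end, the zero spaces before a at the left end,
and the pairing 1 makes the composite the identity. -/
theorem IntervalData.isSummand {a b : ℕ} {ha : a < n + 2} {hb : b < n + 2}
    {x : ∀ v, space X v} {φ : ∀ v, space X v →ₗ[k] k} (h : IntervalData X a b ha hb x φ)
    (h0 : ∀ j (hj : j < n + 2), j < a → Subsingleton (space X (vertex ε j hj))) :
    IsSummand (thin k (interval ε a (b + 1))) X := by
  classical
  refine isSummand_iff.2 ⟨fromThin (fun v => if interval ε a (b + 1) v then x v else 0)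
    (fun v hv => if_neg hv) ?_, toThin (fun v => if interval ε a (b + 1) v then φ v else 0)
    (fun v hv => if_neg hv) ?_, ?_⟩
  · intro s t α hs
    rw [if_pos hs]
    induction α using arrow_induction with
    | right i hi hε =>
      obtain ⟨h1, h2⟩ : a ≤ i ∧ i < b + 1 := hs
      by_cases hib : i = b
      · subst hib
        rw [if_neg (fun h => by simpa using h.2)]
        exact h.right hi hε
      · rw [if_pos ⟨by simp; omega, by simp; omega⟩]
        exact (h.chain i hi h1 (by omega)).1 hε
    | left i hi hε =>
      obtain ⟨h1, h2⟩ : a ≤ i + 1 ∧ i + 1 < b + 1 := hs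
      by_cases hia : i < a
      · have := h0 i (by omega) hia
        exact Subsingleton.elim _ _
      · rw [if_pos ⟨by simp; omega, by simp; omega⟩]
        exact (h.chain i hi (by omega) (by omega)).2 hε
  · intro s t α ht
    rw [if_pos ht]
    induction α using arrow_induction with
    | right i hi hε =>
      obtain ⟨h1, h2⟩ : a ≤ i + 1 ∧ i + 1 < b + 1 := ht
      intro y
      by_cases hia : i < a
      · have := h0 i (by omega) hia
        rw [Subsingleton.elim y 0, map_zero, map_zero, map_zero]
      · rw [if_pos ⟨by simp; omega, by simp; omega⟩]
        exact (h.dualChain i hi (by omega) (by omega)).1 hε y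
    | left i hi hε =>
      obtain ⟨h1, h2⟩ : a ≤ i ∧ i < b + 1 := ht
      intro y
      by_cases hib : i = b
      · subst hib
        rw [if_neg (fun h => by simpa using h.2)]
        exact h.left hi hε y
      · rw [if_pos ⟨by simp; omega, by simp; omega⟩]
        exact (h.dualChain i hi h1 (by omega)).2 hε y
  · refine lin_ext fun v c => ?_
    by_cases hv : interval ε a (b + 1) v
    · refine coord_injective v ?_
      rw [lin_comp, coord_toThin, lin_fromThin, if_pos hv, if_pos hv, map_smul]
      have := h.pairing_eq_one (idx v) hv.1 (Nat.lt_succ_iff.1 hv.2)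
      rw [vertex_idx] at this
      rw [this]
      simp
    · exact (thin_eq_zero hv _).trans (thin_eq_zero hv _).symm

theorem isBrickSystem_chordRep (k : Type u) [Field k] (ε : Fin (n + 1) → Bool) :
    IsBrickSystem (chordRep k ε) where
  isBrick p := isBrick_thin (connectedSupport_interval k p.2.1 p.2.2)
  comp_eq_zero {p q} hpq f g := by
    have hp := p.2
    have hq := q.2
    obtain ⟨v, hv⟩ : ∃ v, ¬ (interval ε p.1.1 p.1.2 v ↔ interval ε q.1.1 q.1.2 v) := by
      by_contra! h
      refine hpq (Subtype.ext (Prod.ext ?_ ?_))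
      · have h1 := h (vertex ε p.1.1 (by omega))
        have h2 := h (vertex ε q.1.1 (by omega))
        simp only [interval, idx_vertex] at h1 h2
        omega
      · have h1 := h (vertex ε (p.1.2 - 1) (by omega))
        have h2 := h (vertex ε (q.1.2 - 1) (by omega))
        simp only [interval, idx_vertex] at h1 h2
        omega
    exact thin_comp_eq_zero (connectedSupport_interval k hp.1 hp.2)
      (connectedSupport_interval k hq.1 hq.2) hv f g
  exists_isSummand X hX := by
    classical
    have h : ∃ j, ∃ hj : j < n + 2, ¬ Subsingleton (space X (vertex ε j hj)) := by
      by_contra! h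
      exact hX (isZero_iff.2 fun v => h (idx v) (idx_lt v))
    obtain ⟨ha, h1⟩ := Nat.find_spec h
    have := not_subsingleton_iff_nontrivial.1 h1
    obtain ⟨b, hb, x, φ, hd⟩ := exists_intervalData (X := X) _ ha
    refine ⟨⟨(Nat.find h, b + 1), Nat.lt_succ_of_le hd.le, by omega⟩,
      hd.isSummand fun j hj hja => ?_⟩
    by_contra h2
    exact Nat.find_min h hja ⟨hj, h2⟩

end QuiverRep

/-! ### Crossing chords as interleaving positions on the boundary -/

/-- The segments interleave. -/
def Interleave (x y : ℕ × ℕ) : Prop :=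
  x.1 < y.1 ∧ y.1 < x.2 ∧ x.2 < y.2 ∨ y.1 < x.1 ∧ x.1 < y.2 ∧ y.2 < x.2

/-- The position of a point on the boundary of the polygon: lower points from left to right, then
upper points from right to left. -/
noncomputable def boundaryKey (N : ℕ) (U : ℕ → Prop) (t : ℕ) : ℕ :=
  open scoped Classical in if U t then 2 * N - t else t

theorem crosses_iff_interleave {N : ℕ} {U : ℕ → Prop} (h0 : ¬ U 0) (hN : ¬ U N) {a b c d : ℕ}
    (hab : a < b) (hb : b ≤ N) (hcd : c < d) (hd : d ≤ N) :
    (a ⊔ c < b ⊓ d ∧ (Traverses U a b c d ∨ Traverses U c d a b)) ↔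
      Interleave (boundaryKey N U a ⊓ boundaryKey N U b, boundaryKey N U a ⊔ boundaryKey N U b)
        (boundaryKey N U c ⊓ boundaryKey N U d, boundaryKey N U c ⊔ boundaryKey N U d) := by
  -- Once the sides are generalized to arbitrary propositions, these eight facts retain all that is
  -- needed: equal points lie on the same side, and the extreme points are lower. Each choice of
  -- sides is then linear arithmetic.
  have hac : a = c → (U a ↔ U c) := fun h => by rw [h]
  have had : a = d → (U a ↔ U d) := fun h => by rw [h]
  have hbc : b = c → (U b ↔ U c) := fun h => by rw [h]
  have hbd : b = d → (U b ↔ U d) := fun h => by rw [h]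
  have ha0 : U a → a ≠ 0 := by rintro h rfl; exact h0 h
  have hc0 : U c → c ≠ 0 := by rintro h rfl; exact h0 h
  have hbN : U b → b ≠ N := by rintro h rfl; exact hN h
  have hdN : U d → d ≠ N := by rintro h rfl; exact hN h
  unfold Traverses Interleave boundaryKey
  generalize U a = A at *
  generalize U b = B at *
  generalize U c = C at *
  generalize U d = D at *
  by_cases hA : A <;> by_cases hB : B <;> by_cases hC : C <;> by_cases hD : D <;>
    simp only [hA, hB, hC, hD, if_true, if_false, iff_true, iff_false, not_true, not_false_iff,
      imp_false, false_and, and_true, and_false, or_false, false_or, true_imp_iff,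
      false_imp_iff, false_iff, implies_true] at * <;> omega

/-! ### Triangulations of a polygon and their number -/

/-- The segments between the points `i, …, j`. -/
def segments (i j : ℕ) : Finset (ℕ × ℕ) :=
  (Finset.Icc i j ×ˢ Finset.Icc i j).filter fun x => x.1 < x.2

@[simp] theorem mem_segments {i j : ℕ} {x : ℕ × ℕ} :
    x ∈ segments i j ↔ i ≤ x.1 ∧ x.1 < x.2 ∧ x.2 ≤ j := by
  simp only [segments, Finset.mem_filter, Finset.mem_product, Finset.mem_Icc]
  omega

/-- A triangulation of the polygon with vertices `i, …, j`: a maximal set of segments that do not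
interleave. -/
structure IsTriangulation (i j : ℕ) (S : Finset (ℕ × ℕ)) : Prop where
  subset : S ⊆ segments i j
  not_interleave : ∀ x ∈ S, ∀ y ∈ S, ¬ Interleave x y
  mem : ∀ x ∈ segments i j, (∀ y ∈ S, ¬ Interleave x y) → x ∈ S

open scoped Classical in
/-- The triangulations of the polygon with vertices `i, …, j`. -/
noncomputable def triangulations (i j : ℕ) : Finset (Finset (ℕ × ℕ)) :=
  (segments i j).powerset.filter (IsTriangulation i j)

theorem mem_triangulations {i j : ℕ} {S : Finset (ℕ × ℕ)} :
    S ∈ triangulations i j ↔ IsTriangulation i j S := by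
  simp only [triangulations, Finset.mem_filter, Finset.mem_powerset, and_iff_right_iff_imp]
  exact fun h => h.subset

namespace IsTriangulation

variable {i j m : ℕ} {S A B : Finset (ℕ × ℕ)}

theorem side_mem (h : IsTriangulation i j S) (hij : i < j) : (i, j) ∈ S :=
  h.mem _ (by simp [hij]) fun y hy => by
    have := mem_segments.1 (h.subset hy)
    unfold Interleave
    omega

/-- Gluing triangulations of two polygons on the sides of the triangle `i`, `m`, `j`. -/
theorem glue (him : i < m) (hmj : m < j) (hA : IsTriangulation i m A)
    (hB : IsTriangulation m j B) : IsTriangulation i j (insert (i, j) (A ∪ B)) where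
  subset x hx := by
    simp only [Finset.mem_insert, Finset.mem_union] at hx
    rw [mem_segments]
    rcases hx with rfl | hx | hx
    · dsimp only
      omega
    · have := mem_segments.1 (hA.subset hx)
      omega
    · have := mem_segments.1 (hB.subset hx)
      omega
  not_interleave x hx y hy := by
    simp only [Finset.mem_insert, Finset.mem_union] at hx hy
    have hA' {z} (hz : z ∈ A) := mem_segments.1 (hA.subset hz)
    have hB' {z} (hz : z ∈ B) := mem_segments.1 (hB.subset hz)
    rcases hx with rfl | hx | hx <;> rcases hy with rfl | hy | hy
    · unfold Interleave; omega
    · have := hA' hy; unfold Interleave; dsimp only; omega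
    · have := hB' hy; unfold Interleave; dsimp only; omega
    · have := hA' hx; unfold Interleave; dsimp only; omega
    · exact hA.not_interleave x hx y hy
    · have := hA' hx; have := hB' hy; unfold Interleave; omega
    · have := hB' hx; unfold Interleave; dsimp only; omega
    · have := hB' hx; have := hA' hy; unfold Interleave; omega
    · exact hB.not_interleave x hx y hy
  mem x hx h := by
    simp only [Finset.mem_insert, Finset.mem_union] at h ⊢
    rw [mem_segments] at hx
    have h1 := h _ (Or.inr (Or.inl (hA.side_mem him)))
    have h2 := h _ (Or.inr (Or.inr (hB.side_mem hmj)))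
    by_cases hxA : x ∈ segments i m
    · exact Or.inr (Or.inl (hA.mem x hxA fun y hy => h y (Or.inr (Or.inl hy))))
    by_cases hxB : x ∈ segments m j
    · exact Or.inr (Or.inr (hB.mem x hxB fun y hy => h y (Or.inr (Or.inr hy))))
    left
    rw [mem_segments] at hxA hxB
    unfold Interleave at h1 h2
    dsimp only at h1 h2
    exact Prod.ext (by dsimp only; omega) (by dsimp only; omega)

/-- The third vertex of the triangle at the side `i`, `j`. -/
theorem exists_apex (h : IsTriangulation i j S) (hij : i + 1 < j) :
    ∃ m, i < m ∧ m < j ∧ (i, m) ∈ S ∧ (m, j) ∈ S := by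
  classical
  have h1 : (i, i + 1) ∈ S := h.mem _ (by simp; omega) fun y hy => by
    have := mem_segments.1 (h.subset hy)
    unfold Interleave
    omega
  -- The apex is the farthest neighbour of i before j. A segment interleaving with (m, j) would
  -- cross (i, m) or join i to a point strictly between m and j.
  obtain ⟨m, hm, hmax⟩ := Finset.exists_max_image
    ((Finset.Ioo i j).filter fun m => (i, m) ∈ S) id ⟨i + 1, by simp [h1, hij]⟩
  simp only [Finset.mem_filter, Finset.mem_Ioo, id] at hm hmax
  refine ⟨m, hm.1.1, hm.1.2, hm.2, h.mem _ (by simp; omega) fun y hy => ?_⟩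
  have h2 := mem_segments.1 (h.subset hy)
  have h3 := h.not_interleave _ hm.2 _ hy
  have h4 : ¬ (y.1 = i ∧ m < y.2 ∧ y.2 < j) := fun ⟨h5, h6, h7⟩ => by
    have := hmax y.2 ⟨by omega, by rw [← h5]; exact hy⟩
    omega
  unfold Interleave at h3 ⊢
  dsimp only at h3 ⊢
  omega

theorem eq_side_or (h : IsTriangulation i j S) (h1 : (i, m) ∈ S) (h2 : (m, j) ∈ S)
    {x : ℕ × ℕ} (hx : x ∈ S) : x = (i, j) ∨ x.2 ≤ m ∨ m ≤ x.1 := by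
  have h3 := mem_segments.1 (h.subset hx)
  have h4 := h.not_interleave _ h1 _ hx
  have h5 := h.not_interleave _ h2 _ hx
  unfold Interleave at h4 h5
  rw [Prod.ext_iff]
  dsimp only at *
  omega

theorem left (h : IsTriangulation i j S) (h1 : (i, m) ∈ S) (h2 : (m, j) ∈ S) :
    IsTriangulation i m (S.filter fun x => x.2 ≤ m) where
  subset x hx := by
    rw [Finset.mem_filter] at hx
    have := mem_segments.1 (h.subset hx.1)
    rw [mem_segments]
    omega
  not_interleave x hx y hy := h.not_interleave x (Finset.mem_of_mem_filter x hx) y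
    (Finset.mem_of_mem_filter y hy)
  mem x hx hS := by
    rw [mem_segments] at hx
    have h3 := mem_segments.1 (h.subset h2)
    refine Finset.mem_filter.2 ⟨h.mem x (mem_segments.2 (by dsimp only at h3; omega))
      fun y hy => ?_, hx.2.2⟩
    by_cases hym : y.2 ≤ m
    · exact hS y (Finset.mem_filter.2 ⟨hy, hym⟩)
    · rcases h.eq_side_or h1 h2 hy with rfl | h4 | h4
      · unfold Interleave
        dsimp only
        omega
      · exact absurd h4 hym
      · unfold Interleave
        omega

theorem right (h : IsTriangulation i j S) (h1 : (i, m) ∈ S) (h2 : (m, j) ∈ S) :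
    IsTriangulation m j (S.filter fun x => m ≤ x.1) where
  subset x hx := by
    rw [Finset.mem_filter] at hx
    have := mem_segments.1 (h.subset hx.1)
    rw [mem_segments]
    omega
  not_interleave x hx y hy := h.not_interleave x (Finset.mem_of_mem_filter x hx) y
    (Finset.mem_of_mem_filter y hy)
  mem x hx hS := by
    rw [mem_segments] at hx
    have h3 := mem_segments.1 (h.subset h1)
    refine Finset.mem_filter.2 ⟨h.mem x (mem_segments.2 (by dsimp only at h3; omega))
      fun y hy => ?_, hx.1⟩
    by_cases hym : m ≤ y.1
    · exact hS y (Finset.mem_filter.2 ⟨hy, hym⟩)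
    · rcases h.eq_side_or h1 h2 hy with rfl | h4 | h4
      · unfold Interleave
        dsimp only
        omega
      · unfold Interleave
        omega
      · exact absurd h4 hym

theorem filter_le (hm : m < j) (hA : IsTriangulation i m A) (hB : IsTriangulation m j B) :
    (insert (i, j) (A ∪ B)).filter (fun x => x.2 ≤ m) = A := by
  ext x
  simp only [Finset.mem_filter, Finset.mem_insert, Finset.mem_union]
  constructor
  · rintro ⟨rfl | hx | hx, h⟩
    · dsimp only at h; omega
    · exact hx
    · have := mem_segments.1 (hB.subset hx); omega
  · exact fun hx => ⟨Or.inr (Or.inl hx), (mem_segments.1 (hA.subset hx)).2.2⟩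

theorem filter_ge (hm : i < m) (hA : IsTriangulation i m A) (hB : IsTriangulation m j B) :
    (insert (i, j) (A ∪ B)).filter (fun x => m ≤ x.1) = B := by
  ext x
  simp only [Finset.mem_filter, Finset.mem_insert, Finset.mem_union]
  constructor
  · rintro ⟨rfl | hx | hx, h⟩
    · dsimp only at h; omega
    · have := mem_segments.1 (hA.subset hx); omega
    · exact hx
  · exact fun hx => ⟨Or.inr (Or.inr hx), (mem_segments.1 (hB.subset hx)).1⟩

theorem card_glue (him : i < m) (hmj : m < j) (hA : IsTriangulation i m A)
    (hB : IsTriangulation m j B) : (insert (i, j) (A ∪ B)).card = A.card + B.card + 1 := by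
  rw [Finset.card_insert_of_notMem, Finset.card_union_of_disjoint]
  · rw [Finset.disjoint_left]
    intro x hx hx'
    have := mem_segments.1 (hA.subset hx)
    have := mem_segments.1 (hB.subset hx')
    omega
  · rw [Finset.mem_union]
    rintro (hx | hx)
    · have := mem_segments.1 (hA.subset hx)
      dsimp only at this
      omega
    · have := mem_segments.1 (hB.subset hx)
      dsimp only at this
      omega

end IsTriangulation

theorem triangulations_eq_biUnion {i j : ℕ} (hij : i + 1 < j) : triangulations i j =
    (Finset.Ioo i j).biUnion fun m => (triangulations i m ×ˢ triangulations m j).image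
      fun p => insert (i, j) (p.1 ∪ p.2) := by
  ext S
  simp only [Finset.mem_biUnion, Finset.mem_image, Finset.mem_product, mem_triangulations,
    Finset.mem_Ioo, Prod.exists]
  constructor
  · intro h
    obtain ⟨m, h1, h2, h3, h4⟩ := h.exists_apex hij
    refine ⟨m, ⟨h1, h2⟩, _, _, ⟨h.left h3 h4, h.right h3 h4⟩, ?_⟩
    ext x
    simp only [Finset.mem_filter, Finset.mem_insert, Finset.mem_union]
    constructor
    · rintro (rfl | hx | hx)
      · exact h.side_mem (by omega)
      · exact hx.1
      · exact hx.1
    · intro hx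
      rcases h.eq_side_or h3 h4 hx with h5 | h5 | h5
      · exact Or.inl h5
      · exact Or.inr (Or.inl ⟨hx, h5⟩)
      · exact Or.inr (Or.inr ⟨hx, h5⟩)
  · rintro ⟨m, ⟨h1, h2⟩, A, B, ⟨hA, hB⟩, rfl⟩
    exact IsTriangulation.glue h1 h2 hA hB

theorem triangulations_succ (i : ℕ) : triangulations i (i + 1) = {{(i, i + 1)}} := by
  have hs : segments i (i + 1) = {(i, i + 1)} := by
    ext x
    rw [mem_segments, Finset.mem_singleton, Prod.ext_iff]
    dsimp only
    omega
  ext S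
  rw [mem_triangulations, Finset.mem_singleton]
  constructor
  · intro h
    refine Finset.Subset.antisymm (hs ▸ h.subset) ?_
    simpa using h.side_mem (by omega)
  · rintro rfl
    refine ⟨by rw [hs], fun x hx y hy => ?_, fun x hx _ => hs ▸ hx⟩
    rw [Finset.mem_singleton.1 hx, Finset.mem_singleton.1 hy]
    unfold Interleave
    omega

/-- For pieces with parameters p + q = N - 1, gluing gives (2p + 1) + (2q + 1) + 1 = 2N + 1. -/
theorem card_of_mem_triangulations (N i : ℕ) {S : Finset (ℕ × ℕ)}
    (hS : S ∈ triangulations i (i + N + 1)) : S.card = 2 * N + 1 := by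
  induction N using Nat.strong_induction_on generalizing i S with
  | _ N ih =>
    rcases N with _ | N
    · rw [Nat.add_zero, triangulations_succ, Finset.mem_singleton] at hS
      simp [hS]
    · rw [triangulations_eq_biUnion (by omega)] at hS
      simp only [Finset.mem_biUnion, Finset.mem_image, Finset.mem_product, Finset.mem_Ioo,
        Prod.exists] at hS
      obtain ⟨m, ⟨h1, h2⟩, A, B, ⟨hA, hB⟩, rfl⟩ := hS
      rw [IsTriangulation.card_glue h1 h2 (mem_triangulations.1 hA) (mem_triangulations.1 hB),
        ih (m - i - 1) (by omega) i (by convert hA using 2; omega),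
        ih (i + N + 1 - m) (by omega) m (by convert hB using 2; omega)]
      omega

/-- The sum over the apex of the triangle on the side (i, j) is the Catalan recursion: the two
pieces are independent and can be recovered by filtering, and the apex is unique. -/
theorem card_triangulations (N i : ℕ) : (triangulations i (i + N + 1)).card = catalan N := by
  induction N using Nat.strong_induction_on generalizing i with
  | _ N ih =>
    rcases N with _ | N
    · rw [Nat.add_zero, triangulations_succ]
      simp
    · rw [triangulations_eq_biUnion (by omega), Finset.card_biUnion, catalan_succ,
        Fin.sum_univ_eq_sum_range (fun t => catalan t * catalan (N - t))]
      · refine Finset.sum_nbij' (fun m => m - i - 1) (fun t => i + t + 1) ?_ ?_ ?_ ?_ ?_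
        · intro m hm
          simp only [Finset.mem_Ioo, Finset.mem_range] at *
          omega
        · intro t ht
          simp only [Finset.mem_Ioo, Finset.mem_range] at *
          omega
        · intro m hm
          simp only [Finset.mem_Ioo] at *
          omega
        · intro t ht
          omega
        · intro m hm
          rw [Finset.mem_Ioo] at hm
          rw [Finset.card_image_of_injOn, Finset.card_product, ← ih (m - i - 1) (by omega) i,
            ← ih (N - (m - i - 1)) (by omega) m]
          · congr 3 <;> omega
          · rintro ⟨A, B⟩ hp ⟨A', B'⟩ hp' h
            simp only [Finset.coe_product, Set.mem_prod, Finset.mem_coe, mem_triangulations]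
              at hp hp'
            dsimp only at h
            refine Prod.ext ?_ ?_
            · rw [← IsTriangulation.filter_le hm.2 hp.1 hp.2, h,
                IsTriangulation.filter_le hm.2 hp'.1 hp'.2]
            · rw [← IsTriangulation.filter_ge hm.1 hp.1 hp.2, h,
                IsTriangulation.filter_ge hm.1 hp'.1 hp'.2]
      · intro m hm m' hm' hne
        rw [Function.onFun, Finset.disjoint_left]
        intro S hS hS'
        simp only [Finset.mem_image, Finset.mem_product, Prod.exists, mem_triangulations]
          at hS hS'
        obtain ⟨A, B, ⟨hA, hB⟩, rfl⟩ := hS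
        obtain ⟨A', B', ⟨hA', hB'⟩, h⟩ := hS'
        rw [Finset.mem_coe, Finset.mem_Ioo] at hm hm'
        have hT := IsTriangulation.glue hm.1 hm.2 hA hB
        -- With two distinct apexes, the side from i to the larger one would interleave with the
        -- side from the smaller one to the right end.
        have h1 := hT.not_interleave (i, m) (by simp [hA.side_mem hm.1]) (m', i + (N + 1) + 1)
          (by rw [← h]; simp [hB'.side_mem hm'.2])
        have h2 := hT.not_interleave (m, i + (N + 1) + 1) (by simp [hB.side_mem hm.2]) (i, m')
          (by rw [← h]; simp [hA'.side_mem hm'.1])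
        unfold Interleave at h1 h2
        dsimp only at h1 h2
        omega

/-! ### Maximal cliques as triangulations -/

section Transport

variable {α : Type} {R : α → α → Prop} {f : α → ℕ × ℕ} {i j : ℕ}

theorem IsTriangulation.isMaximalClique_preimage (hf : Set.range f = segments i j)
    (hR : ∀ x y, R x y ↔ ¬ Interleave (f x) (f y)) {S : Finset (ℕ × ℕ)}
    (hS : IsTriangulation i j S) : IsMaximalClique R (f ⁻¹' (S : Set (ℕ × ℕ))) := by
  refine ⟨fun x hx y hy => (hR x y).2 (hS.not_interleave _ hx _ hy), fun x hx => ?_⟩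
  refine hS.mem _ ((Set.ext_iff.1 hf (f x)).1 ⟨x, rfl⟩) fun y hy => ?_
  obtain ⟨z, rfl⟩ := (Set.ext_iff.1 hf y).2 (hS.subset hy)
  exact (hR x z).1 (hx z hy)

theorem image_preimage_eq_of_subset_segments (hf : Set.range f = segments i j)
    {S : Finset (ℕ × ℕ)} (hS : S ⊆ segments i j) : f '' (f ⁻¹' (S : Set (ℕ × ℕ))) = S :=
  Set.image_preimage_eq_of_subset (by rw [hf]; exact_mod_cast hS)

theorem setOf_isMaximalClique_eq (hi : Function.Injective f) (hf : Set.range f = segments i j)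
    (hR : ∀ x y, R x y ↔ ¬ Interleave (f x) (f y)) :
    {S : Set α | IsMaximalClique R S} =
      (fun S : Finset (ℕ × ℕ) => f ⁻¹' (S : Set (ℕ × ℕ))) '' (triangulations i j : Set (Finset (ℕ × ℕ))) := by
  ext S
  constructor
  · intro hS
    have h1 : f '' S ⊆ segments i j := hf ▸ Set.image_subset_range f S
    have h2 : (f '' S).Finite := (segments i j).finite_toSet.subset h1
    refine ⟨h2.toFinset, ?_, ?_⟩
    · rw [Finset.mem_coe, mem_triangulations]
      refine ⟨by simpa using h1, ?_, ?_⟩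
      · simp only [Set.Finite.mem_toFinset]
        rintro _ ⟨x, hx, rfl⟩ _ ⟨y, hy, rfl⟩
        exact (hR x y).1 (hS.1 x hx y hy)
      · intro x hx h3
        obtain ⟨x, rfl⟩ := (Set.ext_iff.1 hf x).2 hx
        rw [Set.Finite.mem_toFinset]
        exact ⟨x, hS.2 x fun y hy => (hR x y).2 (h3 _ (by simpa using ⟨y, hy, rfl⟩)), rfl⟩
    · simp [Set.preimage_image_eq _ hi]
  · rintro ⟨T, hT, rfl⟩
    exact (mem_triangulations.1 hT).isMaximalClique_preimage hf hR

theorem ncard_of_isMaximalClique {N : ℕ} (hi : Function.Injective f)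
    (hf : Set.range f = segments i (i + N + 1))
    (hR : ∀ x y, R x y ↔ ¬ Interleave (f x) (f y)) {S : Set α} (hS : IsMaximalClique R S) :
    S.ncard = 2 * N + 1 := by
  obtain ⟨T, hT, rfl⟩ := (Set.ext_iff.1 (setOf_isMaximalClique_eq hi hf hR) S).1 hS
  rw [← card_of_mem_triangulations N i hT, ← Set.ncard_image_of_injective _ hi,
    image_preimage_eq_of_subset_segments hf (mem_triangulations.1 hT).subset, Set.ncard_coe_finset]

theorem card_isMaximalClique {N : ℕ} (hi : Function.Injective f)
    (hf : Set.range f = segments i (i + N + 1))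
    (hR : ∀ x y, R x y ↔ ¬ Interleave (f x) (f y)) :
    Nat.card {S : Set α // IsMaximalClique R S} = catalan N := by
  rw [← card_triangulations N i, ← Set.ncard_coe_finset]
  change Set.ncard {S : Set α | IsMaximalClique R S} = _
  rw [setOf_isMaximalClique_eq hi hf hR, Set.InjOn.ncard_image]
  intro S hS T hT h
  have h1 := image_preimage_eq_of_subset_segments hf (mem_triangulations.1 hS).subset
  rw [show f ⁻¹' (S : Set (ℕ × ℕ)) = f ⁻¹' T from h,
    image_preimage_eq_of_subset_segments hf (mem_triangulations.1 hT).subset] at h1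
  exact_mod_cast h1.symm

end Transport

/-! ### Renumbering boundary positions by rank -/

section Rank

/-- The rank of `t` among `0, …, N`, ordered by the value of `g`. -/
def rankBy (N : ℕ) (g : ℕ → ℕ) (t : ℕ) : ℕ :=
  ((Finset.range (N + 1)).filter fun s => g s < g t).card

variable {N : ℕ} {g : ℕ → ℕ}

theorem rankBy_lt_iff {s t : ℕ} (hs : s ≤ N) : rankBy N g s < rankBy N g t ↔ g s < g t := by
  constructor
  · intro h
    by_contra! h1
    exact h.not_ge (Finset.card_le_card fun x hx => by
      rw [Finset.mem_filter] at *
      exact ⟨hx.1, hx.2.trans_le h1⟩)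
  · intro h
    refine Finset.card_lt_card ⟨fun x hx => ?_, fun h1 => ?_⟩
    · rw [Finset.mem_filter] at *
      exact ⟨hx.1, hx.2.trans h⟩
    · have := h1 (Finset.mem_filter.2 ⟨Finset.mem_range.2 (by omega), h⟩)
      simp at this

theorem rankBy_le {t : ℕ} (ht : t ≤ N) : rankBy N g t ≤ N := by
  have : rankBy N g t < (Finset.range (N + 1)).card :=
    Finset.card_lt_card ⟨Finset.filter_subset _ _, fun h => by
      simpa using h (Finset.mem_range.2 (Nat.lt_succ_of_le ht))⟩
  rw [Finset.card_range] at this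
  omega

theorem rankBy_inj (hg : Set.InjOn g (Set.Iic N)) {s t : ℕ} (hs : s ≤ N) (ht : t ≤ N)
    (h : rankBy N g s = rankBy N g t) : s = t := by
  refine hg hs ht ?_
  have h1 := rankBy_lt_iff (g := g) (t := t) hs
  have h2 := rankBy_lt_iff (g := g) (t := s) ht
  omega

theorem exists_rankBy_eq (hg : Set.InjOn g (Set.Iic N)) {r : ℕ} (hr : r ≤ N) :
    ∃ t ≤ N, rankBy N g t = r := by
  have := Finset.surjOn_of_injOn_of_card_le (s := Finset.range (N + 1))
    (t := Finset.range (N + 1)) (rankBy N g)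
    (fun t ht => by
      simp only [Finset.coe_range, Set.mem_Iio, Nat.lt_succ_iff] at *
      exact rankBy_le ht)
    (fun s hs t ht h => by
      simp only [Finset.coe_range, Set.mem_Iio, Nat.lt_succ_iff] at *
      exact rankBy_inj hg hs ht h) le_rfl
  obtain ⟨t, ht, h⟩ := this (show r ∈ _ by simpa using Nat.lt_succ_of_le hr)
  exact ⟨t, by simpa [Nat.lt_succ_iff] using ht, h⟩

theorem interleave_map_iff {r : ℕ → ℕ} {a b c d : ℕ}
    (h : ∀ s ∈ ({a, b, c, d} : Set ℕ), ∀ t ∈ ({a, b, c, d} : Set ℕ), r s < r t ↔ g s < g t) :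
    Interleave (r a ⊓ r b, r a ⊔ r b) (r c ⊓ r d, r c ⊔ r d) ↔
      Interleave (g a ⊓ g b, g a ⊔ g b) (g c ⊓ g d, g c ⊔ g d) := by
  simp only [Interleave, lt_inf_iff, inf_lt_iff, lt_sup_iff, sup_lt_iff]
  simp (discharger := simp) only [h]

end Rank

/-- Lower points have keys at most N; upper points differ from N, so their keys exceed N. -/
theorem injOn_boundaryKey {N : ℕ} {U : ℕ → Prop} (hN : ¬ U N) :
    Set.InjOn (boundaryKey N U) (Set.Iic N) := by
  intro s hs t ht h
  have h1 : U s → s ≠ N := by rintro h3 rfl; exact hN h3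
  have h2 : U t → t ≠ N := by rintro h3 rfl; exact hN h3
  simp only [Set.mem_Iic] at hs ht
  unfold boundaryKey at h
  split_ifs at h with h3 h4 h4 <;> simp only [h3, h4, true_imp_iff] at h1 h2 <;> omega

namespace TypeA

variable {n : ℕ} {ε : Fin (n + 1) → Bool}

theorem not_isUpper_zero : ¬ IsUpper ε 0 := by
  simp [IsUpper]

theorem not_isUpper_last : ¬ IsUpper ε (n + 2) := by
  rintro ⟨i, h, -⟩
  omega

end TypeA

namespace QuiverRep

section Chord

variable {n : ℕ}

theorem finite_chord (n : ℕ) : Finite (Chord n) :=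
  (segments 0 (n + 2)).finite_toSet.subset fun p hp => by
    simpa using show p.1 < p.2 ∧ p.2 ≤ n + 2 from hp

/-- The segment between the ranks of the ends of a chord. -/
def rankSegment (g : ℕ → ℕ) (p : Chord n) : ℕ × ℕ :=
  (rankBy (n + 2) g p.1.1 ⊓ rankBy (n + 2) g p.1.2, rankBy (n + 2) g p.1.1 ⊔ rankBy (n + 2) g p.1.2)

variable {g : ℕ → ℕ}

theorem rankSegment_injective (hg : Set.InjOn g (Set.Iic (n + 2))) :
    Function.Injective (rankSegment (n := n) g) := by
  rintro ⟨⟨a, b⟩, h1, h2⟩ ⟨⟨c, d⟩, h3, h4⟩ h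
  dsimp only at h1 h2 h3 h4
  have hac := rankBy_inj hg (s := a) (t := c) (by omega) (by omega)
  have had := rankBy_inj hg (s := a) (t := d) (by omega) (by omega)
  have hbc := rankBy_inj hg (s := b) (t := c) (by omega) (by omega)
  have hbd := rankBy_inj hg (s := b) (t := d) (by omega) (by omega)
  simp only [rankSegment, Prod.mk.injEq] at h
  simp only [Subtype.mk.injEq, Prod.mk.injEq]
  omega

theorem range_rankSegment (hg : Set.InjOn g (Set.Iic (n + 2))) :
    Set.range (rankSegment (n := n) g) = segments 0 (n + 2) := by
  ext ⟨x, y⟩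
  simp only [Set.mem_range, Finset.mem_coe, mem_segments]
  constructor
  · rintro ⟨⟨⟨a, b⟩, h1, h2⟩, h⟩
    dsimp only at h1 h2
    have h3 := rankBy_inj hg (s := a) (t := b) (by omega) (by omega)
    have h4 := rankBy_le (g := g) (t := a) (N := n + 2) (by omega)
    have h5 := rankBy_le (g := g) (t := b) (N := n + 2) (by omega)
    simp only [rankSegment, Prod.mk.injEq] at h
    omega
  · rintro ⟨-, h1, h2⟩
    obtain ⟨s, hs, rfl⟩ := exists_rankBy_eq hg (r := x) (by omega)
    obtain ⟨t, ht, rfl⟩ := exists_rankBy_eq hg (r := y) h2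
    rcases lt_trichotomy s t with h | rfl | h
    · exact ⟨⟨(s, t), h, ht⟩, by simp [rankSegment, h1.le]⟩
    · exact absurd h1 (lt_irrefl _)
    · exact ⟨⟨(t, s), h, hs⟩, by simp [rankSegment, h1.le]⟩

end Chord

theorem crosses_iff_interleave_rankSegment {n : ℕ} {U : ℕ → Prop} (h0 : ¬ U 0) (hN : ¬ U (n + 2))
    (p q : Chord n) : Crosses U p q ↔
      Interleave (rankSegment (boundaryKey (n + 2) U) p)
        (rankSegment (boundaryKey (n + 2) U) q) := by
  obtain ⟨⟨a, b⟩, h1, h2⟩ := p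
  obtain ⟨⟨c, d⟩, h3, h4⟩ := q
  dsimp only at h1 h2 h3 h4
  refine (crosses_iff_interleave h0 hN h1 h2 h3 h4).trans
    (interleave_map_iff (r := rankBy (n + 2) (boundaryKey (n + 2) U))
      fun s hs t ht => rankBy_lt_iff ?_).symm
  simp only [Set.mem_insert_iff, Set.mem_singleton_iff] at hs
  omega

end QuiverRep

theorem mainTheorem4 (k : Type u) [Field k] [IsAlgClosed k] (n : ℕ) (ε : Fin (n + 1) → Bool) :
    (∀ T : QuiverRep k (TypeA n ε), QuiverRep.IsMaximalAlmostRigid T →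
      T.IsSumOfIndecomposables (2 * n + 3) ∧
      ∀ m : ℕ, T.IsSumOfIndecomposables m → m = 2 * n + 3) ∧
    Nat.card (QuiverRep.mar k (TypeA n ε)) = catalan (n + 1) ∧
    (Nat.card (QuiverRep.mar k (TypeA n ε)) : ℚ) =
      ((2 * n + 2).choose (n + 1) : ℚ) / ((n : ℚ) + 2) := by
  have := QuiverRep.finite_chord n
  have h0 : ¬ TypeA.IsUpper ε 0 := TypeA.not_isUpper_zero
  have hN : ¬ TypeA.IsUpper ε (n + 2) := TypeA.not_isUpper_last
  have hM := QuiverRep.isBrickSystem_chordRep k ε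
  have hC := QuiverRep.isCompatibility_chordRep hM
  have hg := injOn_boundaryKey hN
  have hi := QuiverRep.rankSegment_injective hg
  -- The polygon on 0, …, n + 2 has parameter N = n + 1, whence 2N + 1 = 2n + 3 segments and
  -- `catalan (n + 1)` triangulations.
  have hf : _ = (segments 0 (0 + (n + 1) + 1) : Set (ℕ × ℕ)) :=
    (QuiverRep.range_rankSegment hg).trans (by rw [zero_add])
  have hR := fun p q => not_congr (QuiverRep.crosses_iff_interleave_rankSegment h0 hN p q)
  have hcard : Nat.card (QuiverRep.mar k (TypeA n ε)) = catalan (n + 1) :=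
    (hM.card_mar hC).trans (card_isMaximalClique hi hf hR)
  refine ⟨fun T hT => ?_, hcard, ?_⟩
  · obtain ⟨S, hS, h⟩ := (hM.isSumOfIndecomposables_iff hC hT)
    have h1 : S.ncard = 2 * n + 3 := ncard_of_isMaximalClique hi hf hR hS
    exact ⟨(h _).2 h1.symm, fun m hm => ((h m).1 hm).trans h1⟩
  · rw [hcard, eq_div_iff (by positivity)]
    have h := succ_mul_catalan_eq_centralBinom (n + 1)
    rw [Nat.centralBinom, mul_comm, show 2 * (n + 1) = 2 * n + 2 by ring] at h
    exact_mod_cast h
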